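/- Let $(R,\mathfrak m,k)$ be a commutative noetherian local ring. All modules are finitely generated, and a subcategory of the category $\operatorname{mod}R$ of finitely generated $R$-modules means a full subcategory closed under isomorphism. For a subcategory $\mathsf B$ put $$\mathsf B^\perp=\{L\in\operatorname{mod}R \mid \operatorname{Ext}^i_R(B,L)=0 \text{ for all } B\in\mathsf B \text{ and all } i>0\}.$$ A $\mathsf B$-approximation of a module $M$ is a short exact sequence $0\to L\to B\to M\to 0$ with $B\in\mathsf B$ and $L\in\mathsf B^\perp$. The subcategory $\mathsf B$ is called reflexive if $R\in\mathsf B\cap\mathsf B^\perp$, a direct sum $M\oplus N$ is in $\mathsf B$ if and only if both $M$ and $N$ are, every first syzygy of a module in $\mathsf B$ (the kernel of a surjection onto it from a finitely generated free module) is in $\mathsf B$, and $\operatorname{Hom}_R(B,R)\in\mathsf B$ for every $B\in\mathsf B$. A module is called totally reflexive if it is isomorphic to $\operatorname{Coker}(F_0\to F_{-1})$ for some exact complex $F=(\cdots\to F_{n+1}\to F_n\to F_{n-1}\to\cdots)$, $n\in\mathbb Z$, of finitely generated free $R$-modules such that the complex $\operatorname{Hom}_R(F,R)$ is also exact. The ring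 $R$ is Gorenstein if it has finite injective dimension as a module over itself. **Theorem 3.4.** (a) Let $\mathsf B$ be a reflexive subcategory of $\operatorname{mod}R$. If $k$ has a $\mathsf B$-approximation, then $R$ is Gorenstein or $\mathsf B$ is the category of finitely generated free $R$-modules. (b) Let $\mathsf G$ be the category of totally reflexive $R$-modules. If $\mathsf G$ contains a module that is not free and $k$ has a $\mathsf G$-approximation, then $R$ is Gorenstein. -/

import Mathlib

open CategoryTheory

universe u

/-- The category of finitely generated free `R`-modules. -/
def finFree (R : Type u) [CommRing R] : ObjectProperty (ModuleCat.{u} R) :=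
  fun M => Module.Finite R M ∧ Module.Free R M

/-- The right orthogonal of `B` in the category of finitely generated modules: all finitely
generated `L` with `Ext^i(X, L) = 0` for all `X` in `B` and all `i > 0`. -/
def rightPerp {R : Type u} [CommRing R] (B : ObjectProperty (ModuleCat.{u} R)) :
    ObjectProperty (ModuleCat.{u} R) :=
  fun L => Module.Finite R L ∧
    ∀ X : ModuleCat.{u} R, B X → ∀ i : ℕ, 0 < i → Subsingleton (Abelian.Ext.{u} X L i)

/-- `M` has a `B`-approximation: a short exact sequence `0 → L → X → M → 0` with `X` in `B` and
`L` in the right orthogonal of `B`. -/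
def HasApproximation {R : Type u} [CommRing R] (B : ObjectProperty (ModuleCat.{u} R))
    (M : ModuleCat.{u} R) : Prop :=
  ∃ (L X : ModuleCat.{u} R) (f : L →ₗ[R] X) (g : X →ₗ[R] M),
    rightPerp B L ∧ B X ∧
      Function.Injective f ∧ Function.Exact f g ∧ Function.Surjective g

/-- Reflexive subcategories of the category of finitely generated `R`-modules. A full subcategory
is given by its class of objects, which is closed under isomorphism. -/
structure IsReflexiveSubcategory {R : Type u} [CommRing R]
    (B : ObjectProperty (ModuleCat.{u} R)) : Prop where
  finite : ∀ M : ModuleCat.{u} R, B M → Module.Finite R M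
  iso : ∀ M N : ModuleCat.{u} R, Nonempty (M ≃ₗ[R] N) → B M → B N
  self_mem : B (ModuleCat.of R R)
  self_mem_perp : rightPerp B (ModuleCat.of R R)
  /-- A direct sum is in `B` if and only if both summands are. -/
  prod_iff : ∀ M N : ModuleCat.{u} R, B (ModuleCat.of R (M × N)) ↔ B M ∧ B N
  /-- Every first syzygy (kernel of a surjection from a finitely generated free module) of a module
  in `B` is in `B`. -/
  syzygy : ∀ (K F M : ModuleCat.{u} R) (f : K →ₗ[R] F) (g : F →ₗ[R] M), finFree R F →
    Function.Injective f → Function.Exact f g → Function.Surjective g → B M → B K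
  dual : ∀ M : ModuleCat.{u} R, B M → B (ModuleCat.of R (Module.Dual R M))

/-- Totally reflexive modules: those isomorphic to `Coker (d₀ : F₀ → F₋₁)` for an exact complex
`⋯ → Fₙ₊₁ → Fₙ → Fₙ₋₁ → ⋯` of finitely generated free modules whose dual complex `Hom(F, R)` is
exact too. -/
def totallyReflexive (R : Type u) [CommRing R] : ObjectProperty (ModuleCat.{u} R) :=
  fun M => ∃ F : ChainComplex (ModuleCat.{u} R) ℤ,
    (∀ n : ℤ, finFree R (F.X n)) ∧
    (∀ n : ℤ, Function.Exact (F.d (n + 1) n).hom (F.d n (n - 1)).hom) ∧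
    (∀ n : ℤ, Function.Exact (F.d n (n - 1)).hom.dualMap (F.d (n + 1) n).hom.dualMap) ∧
    Nonempty (M ≃ₗ[R] (F.X (-1) ⧸ LinearMap.range (F.d 0 (-1)).hom))

/-- A (noetherian local) ring is Gorenstein if it has finite injective dimension as a module over
itself. -/
def IsGorensteinLocal (R : Type u) [CommRing R] : Prop :=
  ∃ n : ℕ, HasInjectiveDimensionLE (ModuleCat.of R R) n

/-! Suppose the class contains a module that is not free, and let 0 → L → B → k → 0 be the
approximation. Only closure under syzygies and duals and the vanishing of Ext(-, R) in positive
degrees are used (`IsSyzygyDualClosed`). Dualizing successive minimal syzygies of the nonfree module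
gives minimal exact sequences 0 → Y_n → Q_n → Y_(n+1) → 0 with Q_n ≠ 0 free, whose duals are exact
too. By minimality Ext^j(k, Y_(n+1)*) → Ext^j(k, Q_n*) is surjective
(`exists_ext_residueField_comp_homPrecomp_eq`). Since L is right orthogonal to the class, K ⊗ L ≅
Hom(K*, L) for K in the class. This makes K ⊗ L → K ⊗ B injective and Ext^j(L, Hom(K, I)) zero for
injective I and j > 0. With minimality it follows that Ext^j(k, Y_n*) → Ext^j(B, Y_n*) is injective
(`eq_zero_of_residueField_precomp_eq_zero`). The groups Ext^(n+1)(B, Y_n*) are all quotients of the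
noetherian module Ext^1(B, Y_0*), via connecting maps. The images of Ext^(n+1)(k, Y_n*) pull back to
an ascending chain there, which stabilizes. From then on every class in Ext^(n+2)(k, Y_(n+1)*) is a
connecting image, hence dies in Ext^(n+2)(k, Q_n*); by surjectivity that group is zero. So Ext^m(k,
R) = 0 for large m, and R is Gorenstein. For totally reflexive modules the argument is applied to
their closure under stable direct summands, where closure under all syzygies follows from Schanuel's
lemma. -/

/-! ### Vanishing of Ext along short exact sequences and retracts. -/

section ExtVanishing

variable {R : Type u} [CommRing R]

open Abelian

/-- The short exact sequence of modules given by linear maps. -/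
theorem shortExact_of_linearMap {A B C : Type u} [AddCommGroup A] [AddCommGroup B] [AddCommGroup C]
    [Module R A] [Module R B] [Module R C] {f : A →ₗ[R] B} {g : B →ₗ[R] C}
    (hf : Function.Injective f) (hfg : Function.Exact f g) (hg : Function.Surjective g) :
    (ModuleCat.shortComplexOfCompEqZero f g hfg.linearMap_comp_eq_zero).ShortExact :=
  ModuleCat.shortComplex_shortExact _ hfg hf hg

variable {S : ShortComplex (ModuleCat.{u} R)}

theorem subsingleton_ext_X₂ (hS : S.ShortExact) {Y : ModuleCat.{u} R} {n : ℕ}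
    (h₁ : Subsingleton (Ext.{u} S.X₁ Y n)) (h₃ : Subsingleton (Ext.{u} S.X₃ Y n)) :
    Subsingleton (Ext.{u} S.X₂ Y n) := by
  refine subsingleton_of_forall_eq 0 fun x => ?_
  obtain ⟨y, rfl⟩ := Ext.contravariant_sequence_exact₂ hS Y x (Subsingleton.elim _ _)
  rw [Subsingleton.elim y 0, Ext.comp_zero]

theorem subsingleton_ext_X₃ (hS : S.ShortExact) {Y : ModuleCat.{u} R} {n : ℕ}
    (h₂ : Subsingleton (Ext.{u} S.X₂ Y (n + 1))) (h₁ : Subsingleton (Ext.{u} S.X₁ Y n)) :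
    Subsingleton (Ext.{u} S.X₃ Y (n + 1)) := by
  refine subsingleton_of_forall_eq 0 fun x => ?_
  obtain ⟨y, rfl⟩ := Ext.contravariant_sequence_exact₃ hS Y x (Subsingleton.elim _ _)
    (add_comm 1 n)
  rw [Subsingleton.elim y 0, Ext.comp_zero]

theorem subsingleton_ext_to_X₃ (hS : S.ShortExact) {X : ModuleCat.{u} R} {n : ℕ}
    (h₂ : Subsingleton (Ext.{u} X S.X₂ n)) (h₁ : Subsingleton (Ext.{u} X S.X₁ (n + 1))) :
    Subsingleton (Ext.{u} X S.X₃ n) := by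
  refine subsingleton_of_forall_eq 0 fun x => ?_
  obtain ⟨y, rfl⟩ := Ext.covariant_sequence_exact₃ X hS x rfl (Subsingleton.elim _ _)
  rw [Subsingleton.elim y 0, Ext.zero_comp]

theorem subsingleton_ext_to_X₁ (hS : S.ShortExact) {X : ModuleCat.{u} R} {n : ℕ}
    (h₂ : Subsingleton (Ext.{u} X S.X₂ (n + 1))) (h₃ : Subsingleton (Ext.{u} X S.X₃ n)) :
    Subsingleton (Ext.{u} X S.X₁ (n + 1)) := by
  refine subsingleton_of_forall_eq 0 fun x => ?_
  obtain ⟨y, rfl⟩ := Ext.covariant_sequence_exact₁ X hS x (Subsingleton.elim _ _) rfl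
  rw [Subsingleton.elim y 0, Ext.zero_comp]

theorem subsingleton_ext_of_retract {X X' Y : ModuleCat.{u} R} (h : Retract X X') {n : ℕ}
    (h' : Subsingleton (Ext.{u} X' Y n)) : Subsingleton (Ext.{u} X Y n) := by
  refine subsingleton_of_forall_eq 0 fun x => ?_
  rw [← x.mk₀_id_comp, ← h.retract, ← Ext.mk₀_comp_mk₀_assoc,
    Subsingleton.elim ((Ext.mk₀ h.r).comp x (zero_add n)) 0, Ext.comp_zero]

theorem subsingleton_ext_to_of_retract {X Y Y' : ModuleCat.{u} R} (h : Retract Y Y') {n : ℕ}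
    (h' : Subsingleton (Ext.{u} X Y' n)) : Subsingleton (Ext.{u} X Y n) := by
  refine subsingleton_of_forall_eq 0 fun x => ?_
  rw [← x.comp_mk₀_id, ← h.retract, ← Ext.mk₀_comp_mk₀, ← Ext.comp_assoc_of_second_deg_zero,
    Subsingleton.elim (x.comp (Ext.mk₀ h.i) (add_zero n)) 0, Ext.zero_comp]

theorem subsingleton_ext_of_isZero {X Y : ModuleCat.{u} R} (h : Limits.IsZero X) (n : ℕ) :
    Subsingleton (Ext.{u} X Y n) := by
  refine subsingleton_of_forall_eq 0 fun x => ?_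
  rw [← x.mk₀_id_comp, h.eq_of_src (𝟙 X) 0, Ext.mk₀_zero, Ext.zero_comp]

end ExtVanishing

/-! ### Finite injective dimension from vanishing of Ext(k, -). -/

section InjectiveDimension

variable {R : Type u} [CommRing R]

open Abelian

/-- An embedding into an injective module, as a short exact sequence. -/
theorem exists_injective_shortExact (M : ModuleCat.{u} R) :
    ∃ (I M' : ModuleCat.{u} R) (f : M →ₗ[R] I) (g : I →ₗ[R] M'), Injective I ∧
      Function.Injective f ∧ Function.Exact f g ∧ Function.Surjective g := by
  obtain ⟨I, _, f, _⟩ := EnoughInjectives.presentation M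
  exact ⟨I, ModuleCat.of R (I ⧸ f.hom.range), f.hom, f.hom.range.mkQ, ‹_›,
    (ModuleCat.mono_iff_injective f).mp ‹_›, f.hom.exact_map_mkQ_range,
    Submodule.mkQ_surjective _⟩

/-- Baer's criterion settles N = 0; replacing M by its cosyzygy lowers N by one. -/
theorem hasInjectiveDimensionLE_of_subsingleton_ext_quotient (M : ModuleCat.{u} R) (N : ℕ)
    (h : ∀ m, N < m → ∀ I : Ideal R, Subsingleton (Ext.{u} (ModuleCat.of R (R ⧸ I)) M m)) :
    HasInjectiveDimensionLE M N := by
  induction N generalizing M with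
  | zero =>
    rw [HasInjectiveDimensionLE, zero_add, ← injective_iff_hasInjectiveDimensionLT_one]
    have : Module.Injective R M := by
      refine Module.Baer.injective fun I g => ?_
      have hS := shortExact_of_linearMap (R := R) I.injective_subtype
        (LinearMap.exact_subtype_mkQ I) I.mkQ_surjective
      have := h 1 one_pos I
      obtain ⟨y, hy⟩ := Ext.contravariant_sequence_exact₁ hS M
        (Ext.mk₀ (ModuleCat.ofHom g)) (add_zero 1) (Subsingleton.elim _ _)
      obtain ⟨y, rfl⟩ := (Ext.mk₀_bijective _ _).2 y
      rw [Ext.mk₀_comp_mk₀] at hy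
      have hy := (Ext.mk₀_bijective _ _).1 hy
      exact ⟨y.hom, fun x mem => LinearMap.congr_fun (ModuleCat.hom_ext_iff.1 hy) ⟨x, mem⟩⟩
    exact Module.injective_object_of_injective_module R M
  | succ N ih =>
    obtain ⟨I, M', f, g, hI, hf, hfg, hg⟩ := exists_injective_shortExact M
    have hS := shortExact_of_linearMap hf hfg hg
    refine (hS.hasInjectiveDimensionLT_X₃_iff N hI).1 (ih M' fun m hm J => ?_)
    obtain ⟨m, rfl⟩ := Nat.exists_eq_succ_of_ne_zero (Nat.ne_zero_of_lt hm)
    exact subsingleton_ext_to_X₃ hS (Ext.subsingleton_of_injective _ I _) (h _ (by lia) J)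

theorem exact_quotient_sup_span_singleton (I : Ideal R) (a : R) {M : Type u} [AddCommGroup M]
    [Module R M] (f : M →ₗ[R] R ⧸ I) (hf : f.range = (R ∙ (Ideal.Quotient.mk I a : R ⧸ I))) :
    Function.Exact f (Submodule.factor (le_sup_left : I ≤ I ⊔ Ideal.span {a})) := by
  rw [LinearMap.exact_iff, hf]
  ext x
  obtain ⟨x, rfl⟩ := Ideal.Quotient.mk_surjective x
  rw [Submodule.mem_span_singleton, LinearMap.mem_ker]
  change Ideal.Quotient.mk _ x = 0 ↔ _
  rw [Ideal.Quotient.eq_zero_iff_mem, sup_comm, Ideal.mem_span_singleton_sup]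
  constructor
  · rintro ⟨r, b, hb, rfl⟩
    refine ⟨r, ?_⟩
    change Ideal.Quotient.mk I (r * a) = _
    rw [Ideal.Quotient.mk_eq_mk_iff_sub_mem]
    simpa using I.neg_mem hb
  · rintro ⟨r, hr⟩
    change Ideal.Quotient.mk I (r * a) = _ at hr
    rw [eq_comm, Ideal.Quotient.mk_eq_mk_iff_sub_mem] at hr
    exact ⟨r, _, hr, by ring⟩

/-- If the modules `Ext^m(k, M)` vanish in all large degrees, then so do the `Ext^m(R ⧸ I, M)`. -/
theorem subsingleton_ext_quotient_of_residueField [IsNoetherianRing R] [IsLocalRing R]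
    (M : ModuleCat.{u} R) [Module.Finite R M] (N : ℕ)
    (h : ∀ m, N < m → Subsingleton
      (Ext.{u} (ModuleCat.of R (IsLocalRing.ResidueField R)) M m)) (I : Ideal R) :
    ∀ m, N < m → Subsingleton (Ext.{u} (ModuleCat.of R (R ⧸ I)) M m) := by
  induction I using WellFoundedGT.induction with
  | ind I ih =>
  intro m hm
  by_cases htop : I = ⊤
  · have : Subsingleton (R ⧸ I) := Ideal.Quotient.subsingleton_iff.2 htop
    exact subsingleton_ext_of_isZero (ModuleCat.isZero_of_subsingleton _) m
  by_cases hmax : I = IsLocalRing.maximalIdeal R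
  · subst hmax
    exact h m hm
  have hlt : ∀ a, a ∉ I → I < I ⊔ Ideal.span {a} := fun a ha =>
    lt_of_le_of_ne le_sup_left fun e => ha (e ▸ Ideal.mem_sup_right (Ideal.mem_span_singleton_self a))
  by_cases hprime : I.IsPrime
  -- For I prime and not maximal, a in 𝔪 \ I is regular on R/I, with cokernel R/(I + (a)).
  · obtain ⟨a, ham, haI⟩ := Set.exists_of_ssubset
      (lt_of_le_of_ne (IsLocalRing.le_maximalIdeal htop) hmax : I < _)
    have hS := shortExact_of_linearMap (f := a • (LinearMap.id : (R ⧸ I) →ₗ[R] (R ⧸ I)))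
      (by
        rw [injective_iff_map_eq_zero]
        intro x hx
        obtain ⟨x, rfl⟩ := Ideal.Quotient.mk_surjective x
        change Ideal.Quotient.mk I (a * x) = 0 at hx
        rw [Ideal.Quotient.eq_zero_iff_mem] at hx ⊢
        exact (hprime.mem_or_mem hx).resolve_left haI)
      (exact_quotient_sup_span_singleton I a _ (by
        ext x
        rw [Submodule.mem_span_singleton]
        constructor
        · rintro ⟨y, rfl⟩
          obtain ⟨y, rfl⟩ := Ideal.Quotient.mk_surjective y
          exact ⟨y, congrArg (Ideal.Quotient.mk I) (mul_comm y a)⟩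
        · rintro ⟨y, rfl⟩
          exact ⟨Ideal.Quotient.mk I y, congrArg (Ideal.Quotient.mk I) (mul_comm a y)⟩))
      (Submodule.factor_surjective _)
    have hsub : Subsingleton (Ext.{u} (ModuleCat.of R (R ⧸ I ⊔ Ideal.span {a})) M (m + 1)) :=
      ih _ (hlt a haI) (m + 1) (by lia)
    -- Multiplication by a is surjective on the finitely generated module Ext^m(R/I, M), so Nakayama
    -- applies.
    refine Submodule.subsingleton_iff R |>.1 <| (subsingleton_iff_bot_eq_top).1 <| Eq.symm <|
      Submodule.eq_bot_of_le_smul_of_le_jacobson_bot (Ideal.span {a}) _ Module.Finite.fg_top ?_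
        ?_
    · intro x _
      obtain ⟨y, rfl⟩ := Ext.contravariant_sequence_exact₁ hS M x (add_comm 1 m)
        (hsub.elim _ _)
      have : (Ext.mk₀ (ModuleCat.ofHom (a • (LinearMap.id : (R ⧸ I) →ₗ[R] (R ⧸ I))))).comp y
          (zero_add m) = a • y := by
        have e : ModuleCat.ofHom (a • (LinearMap.id : (R ⧸ I) →ₗ[R] (R ⧸ I)))
          = a • 𝟙 (ModuleCat.of R (R ⧸ I)) := rfl
        rw [e, Ext.mk₀_smul, Ext.smul_comp, Ext.mk₀_id_comp]
      erw [this]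
      exact Submodule.smul_mem_smul (Ideal.mem_span_singleton_self a) trivial
    · rw [IsLocalRing.jacobson_eq_maximalIdeal _ bot_ne_top]
      simpa using ham
  · rw [Ideal.isPrime_iff] at hprime
    push Not at hprime
    obtain ⟨a, b, hab, ha, hb⟩ := hprime htop
    -- For I not prime, 0 → R/(I : a) → R/I → R/(I + (a)) → 0 has both outer ideals strictly larger
    -- than I; b witnesses this for the colon ideal.
    let J : Ideal R := I.colon {a}
    have hJ : ∀ x, x ∈ J ↔ a * x ∈ I := fun x => by
      rw [Submodule.mem_colon_singleton, smul_eq_mul, mul_comm]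
    have hle : J ≤ Submodule.comap (LinearMap.mulLeft R a) I := fun x hx => (hJ x).1 hx
    have hS := shortExact_of_linearMap (f := Submodule.mapQ J I (LinearMap.mulLeft R a) hle)
      (by
        rw [injective_iff_map_eq_zero]
        intro x hx
        obtain ⟨x, rfl⟩ := Ideal.Quotient.mk_surjective x
        change Ideal.Quotient.mk I (a * x) = 0 at hx
        rw [Ideal.Quotient.eq_zero_iff_mem] at hx ⊢
        exact (hJ x).2 hx)
      (exact_quotient_sup_span_singleton I a _ (by
        ext x
        rw [Submodule.mem_span_singleton]
        constructor
        · rintro ⟨y, rfl⟩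
          obtain ⟨y, rfl⟩ := Ideal.Quotient.mk_surjective y
          exact ⟨y, congrArg (Ideal.Quotient.mk I) (mul_comm y a)⟩
        · rintro ⟨y, rfl⟩
          exact ⟨Ideal.Quotient.mk J y, congrArg (Ideal.Quotient.mk I) (mul_comm a y)⟩))
      (Submodule.factor_surjective _)
    refine subsingleton_ext_X₂ hS (ih J ?_ m hm) (ih _ (hlt a ha) m hm)
    refine lt_of_le_of_ne (fun x hx => (hJ x).2 (I.mul_mem_left a hx)) fun e => hb ?_
    rw [e]
    exact (hJ b).2 hab

theorem isGorensteinLocal_of_subsingleton_ext [IsNoetherianRing R] [IsLocalRing R] (N : ℕ)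
    (h : ∀ m, N < m → Subsingleton
      (Ext.{u} (ModuleCat.of R (IsLocalRing.ResidueField R)) (ModuleCat.of R R) m)) :
    IsGorensteinLocal R :=
  ⟨N, hasInjectiveDimensionLE_of_subsingleton_ext_quotient _ N fun m hm I =>
    subsingleton_ext_quotient_of_residueField _ N h I m hm⟩

end InjectiveDimension

/-! ### The map K ⊗ C → Hom(K*, C), lifting criteria and minimal syzygies. -/

section LinearAlgebra

variable {R : Type u} [CommRing R]

open TensorProduct Abelian

/-- The natural map `K ⊗ C → Hom(K*, C)`. -/
noncomputable def tensorToHomDual (K C : Type u) [AddCommGroup K] [Module R K] [AddCommGroup C]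
    [Module R C] : K ⊗[R] C →ₗ[R] Module.Dual R K →ₗ[R] C :=
  dualTensorHom R (Module.Dual R K) C ∘ₗ (Module.Dual.eval R K).rTensor C

variable {A B D K F C C' : Type u} [AddCommGroup A] [AddCommGroup B] [AddCommGroup D]
  [AddCommGroup K] [AddCommGroup F] [AddCommGroup C] [AddCommGroup C'] [Module R A] [Module R B]
  [Module R D] [Module R K] [Module R F] [Module R C] [Module R C']

@[simp]
theorem tensorToHomDual_tmul (x : K) (c : C) (φ : Module.Dual R K) :
    tensorToHomDual (R := R) K C (x ⊗ₜ c) φ = φ x • c := by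
  simp [tensorToHomDual]

theorem tensorToHomDual_rTensor (f : K →ₗ[R] F) (t : K ⊗[R] C) :
    tensorToHomDual F C (f.rTensor C t) = tensorToHomDual K C t ∘ₗ f.dualMap := by
  induction t with
  | zero => simp
  | add x y hx hy => simp [hx, hy, LinearMap.add_comp]
  | tmul x y => ext φ; simp

theorem tensorToHomDual_lTensor (g : C →ₗ[R] C') (t : K ⊗[R] C) :
    tensorToHomDual K C' (g.lTensor K t) = g ∘ₗ tensorToHomDual K C t := by
  induction t with
  | zero => simp
  | add x y hx hy => simp [hx, hy, LinearMap.comp_add]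
  | tmul x y => ext φ; simp

theorem tensorToHomDual_bijective_of_free [Module.Finite R F] [Module.Free R F] :
    Function.Bijective (tensorToHomDual (R := R) F C) := by
  have h : tensorToHomDual (R := R) F C = ((Module.evalEquiv R F).rTensor C ≪≫ₗ
      dualTensorHomEquiv (R := R) (M := Module.Dual R F) (N := C)).toLinearMap := by
    ext x c φ
    simp
  rw [h]
  exact LinearEquiv.bijective _

/-- A homomorphism into a module `C` with `Ext^1(D, C) = 0` extends along an injection with
cokernel `D`. -/
theorem exists_comp_eq_of_subsingleton_ext_one {f : A →ₗ[R] B} {g : B →ₗ[R] D}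
    (hf : Function.Injective f) (hfg : Function.Exact f g) (hg : Function.Surjective g)
    (h : Subsingleton (Ext.{u} (ModuleCat.of R D) (ModuleCat.of R C) 1)) (φ : A →ₗ[R] C) :
    ∃ ψ : B →ₗ[R] C, ψ ∘ₗ f = φ := by
  obtain ⟨y, hy⟩ := Ext.contravariant_sequence_exact₁ (shortExact_of_linearMap hf hfg hg)
    (ModuleCat.of R C) (Ext.mk₀ (ModuleCat.ofHom φ)) (add_zero 1) (h.elim _ _)
  obtain ⟨y, rfl⟩ := (Ext.mk₀_bijective _ _).2 y
  rw [Ext.mk₀_comp_mk₀] at hy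
  have hy := (Ext.mk₀_bijective _ _).1 hy
  exact ⟨y.hom, ModuleCat.hom_ext_iff.1 hy⟩

theorem lcomp_surjective_of_subsingleton_ext_one {f : A →ₗ[R] B} {g : B →ₗ[R] D}
    (hf : Function.Injective f) (hfg : Function.Exact f g) (hg : Function.Surjective g)
    (h : Subsingleton (Ext.{u} (ModuleCat.of R D) (ModuleCat.of R C) 1)) :
    Function.Surjective (f.lcomp R C) :=
  exists_comp_eq_of_subsingleton_ext_one hf hfg hg h

/-- Postcomposition by an epimorphism with kernel `A` on homomorphisms from `C` is surjective if
`Ext^1(C, A) = 0`. -/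
theorem compRight_surjective_of_subsingleton_ext_one {f : A →ₗ[R] B} {g : B →ₗ[R] D}
    (hf : Function.Injective f) (hfg : Function.Exact f g) (hg : Function.Surjective g)
    (h : Subsingleton (Ext.{u} (ModuleCat.of R C) (ModuleCat.of R A) 1)) :
    Function.Surjective (g.compRight R : (C →ₗ[R] B) →ₗ[R] C →ₗ[R] D) := by
  intro φ
  obtain ⟨y, hy⟩ := Ext.covariant_sequence_exact₃ (ModuleCat.of R C)
    (shortExact_of_linearMap hf hfg hg) (Ext.mk₀ (ModuleCat.ofHom φ)) (zero_add 1) (h.elim _ _)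
  obtain ⟨y, rfl⟩ := (Ext.mk₀_bijective _ _).2 y
  rw [Ext.mk₀_comp_mk₀] at hy
  have hy := (Ext.mk₀_bijective _ _).1 hy
  exact ⟨y.hom, ModuleCat.hom_ext_iff.1 hy⟩

theorem subsingleton_ext_one_of_compRight_surjective {f : A →ₗ[R] B} {g : B →ₗ[R] D}
    (hf : Function.Injective f) (hfg : Function.Exact f g) (hg : Function.Surjective g)
    (hB : Injective (ModuleCat.of R B))
    (h : Function.Surjective (g.compRight R : (C →ₗ[R] B) →ₗ[R] C →ₗ[R] D)) :
    Subsingleton (Ext.{u} (ModuleCat.of R C) (ModuleCat.of R A) 1) := by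
  refine subsingleton_of_forall_eq 0 fun x => ?_
  obtain ⟨y, rfl⟩ := Ext.covariant_sequence_exact₁ (ModuleCat.of R C)
    (shortExact_of_linearMap hf hfg hg) x (@Ext.eq_zero_of_injective _ _ _ _ _ _ _ hB _) rfl
  obtain ⟨y, rfl⟩ := (Ext.mk₀_bijective _ _).2 y
  obtain ⟨φ, hφ⟩ := h y.hom
  have hy : y = ModuleCat.ofHom φ ≫ ModuleCat.ofHom g := ModuleCat.hom_ext hφ.symm
  rw [hy, ← Ext.mk₀_comp_mk₀, Ext.comp_assoc_of_second_deg_zero,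
    (shortExact_of_linearMap hf hfg hg).comp_extClass, Ext.comp_zero]

theorem compRight_injective {f : A →ₗ[R] B} (hf : Function.Injective f) :
    Function.Injective (f.compRight R : (C →ₗ[R] A) →ₗ[R] C →ₗ[R] B) := by
  intro φ ψ h
  ext x
  exact hf (LinearMap.congr_fun h x)

theorem exact_compRight {f : A →ₗ[R] B} {g : B →ₗ[R] D}
    (hf : Function.Injective f) (hfg : Function.Exact f g) :
    Function.Exact (f.compRight R : (C →ₗ[R] A) →ₗ[R] C →ₗ[R] B) (g.compRight R) := by
  intro φ
  constructor
  · intro h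
    exact ⟨LinearMap.codRestrictOfInjective φ f hf fun x => (hfg _).1 (LinearMap.congr_fun h x),
      LinearMap.codRestrictOfInjective_comp _ _ _ _⟩
  · rintro ⟨ψ, rfl⟩
    ext x
    exact hfg.apply_apply_eq_zero _

/-- Hom(-, Hom(F, C)) is Hom(- ⊗ F, C), a composite of exact functors. -/
theorem injective_hom_of_flat [Module.Flat R F] [Module.Injective R C] :
    Module.Injective R (F →ₗ[R] C) where
  out X Y _ _ _ _ i hi g := by
    obtain ⟨h, hh⟩ := Module.Injective.out (i.rTensor F)
      (Module.Flat.rTensor_preserves_injective_linearMap i hi) (TensorProduct.lift g)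
    exact ⟨TensorProduct.curry h, fun x => by ext y; simpa using hh (x ⊗ₜ y)⟩

/-- A finitely generated module has a first syzygy. -/
theorem exists_syzygy [IsNoetherianRing R] (M : ModuleCat.{u} R) [Module.Finite R M] :
    ∃ (K F : ModuleCat.{u} R) (f : K →ₗ[R] F) (g : F →ₗ[R] M), finFree R F ∧
      Function.Injective f ∧ Function.Exact f g ∧ Function.Surjective g := by
  obtain ⟨N, _, _, _, _, g, hg⟩ := Module.exists_finite_presentation R M
  exact ⟨ModuleCat.of R (LinearMap.ker g), ModuleCat.of R N, (LinearMap.ker g).subtype, g,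
    ⟨‹_›, ‹_›⟩, Subtype.val_injective, LinearMap.exact_subtype_ker_map g, hg⟩

/-- A finitely generated module over a local ring has a minimal first syzygy. -/
theorem exists_minimal_syzygy [IsNoetherianRing R] [IsLocalRing R] (M : ModuleCat.{u} R)
    [Module.Finite R M] :
    ∃ (K F : ModuleCat.{u} R) (f : K →ₗ[R] F) (g : F →ₗ[R] M), finFree R F ∧
      Function.Injective f ∧ Function.Exact f g ∧ Function.Surjective g ∧
      LinearMap.range f ≤ IsLocalRing.maximalIdeal R • ⊤ := by
  have : Module.Free (IsLocalRing.ResidueField R) (IsLocalRing.ResidueField R ⊗[R] M) :=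
    Module.Free.of_divisionRing _ _
  let w := Module.Free.chooseBasis (IsLocalRing.ResidueField R) (IsLocalRing.ResidueField R ⊗[R] M)
  -- Generators lifted from a basis of k ⊗ M: they span by Nakayama, and any relation among them has
  -- coefficients in 𝔪.
  obtain ⟨v, hv⟩ := (TensorProduct.mk_surjective R M (IsLocalRing.ResidueField R)
    Ideal.Quotient.mk_surjective).comp_left w
  let g : (Module.Free.ChooseBasisIndex (IsLocalRing.ResidueField R)
      (IsLocalRing.ResidueField R ⊗[R] M) → R) →ₗ[R] M := Fintype.linearCombination R v
  have hg : Function.Surjective g := by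
    rw [← LinearMap.range_eq_top, Fintype.range_linearCombination]
    exact IsLocalRing.span_eq_top_of_tmul_eq_basis v w fun i => congr_fun hv i
  refine ⟨ModuleCat.of R (LinearMap.ker g), ModuleCat.of R (_ → R), (LinearMap.ker g).subtype, g,
    ⟨inferInstance, inferInstance⟩, Subtype.val_injective, LinearMap.exact_subtype_ker_map g, hg, ?_⟩
  rw [Submodule.range_subtype]
  intro x hx
  have hx' : ∑ i, IsLocalRing.residue R (x i) • w i = 0 := by
    have h := congrArg (TensorProduct.mk R (IsLocalRing.ResidueField R) M 1) (LinearMap.mem_ker.1 hx)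
    rw [map_zero, Fintype.linearCombination_apply, map_sum] at h
    rw [← h]
    refine Finset.sum_congr rfl fun i _ => ?_
    rw [map_smul, ← congr_fun hv i]
    rfl
  have hmem : ∀ i, x i ∈ IsLocalRing.maximalIdeal R := fun i =>
    (IsLocalRing.residue_eq_zero_iff _).1 (Fintype.linearIndependent_iff.1 w.linearIndependent _ hx' i)
  classical
  rw [pi_eq_sum_univ' x]
  exact Submodule.sum_mem _ fun i _ => Submodule.smul_mem_smul (hmem i) trivial

end LinearAlgebra

/-! ### Tensor products with modules of the right orthogonal. -/

section DualSyzygyClosed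

open TensorProduct Abelian LinearMap

/-- A class of finitely generated modules that is closed under first syzygies and duals and is left
orthogonal to the ring. -/
structure IsSyzygyDualClosed {R : Type u} [CommRing R] (P : ObjectProperty (ModuleCat.{u} R)) :
    Prop where
  finite : ∀ M : ModuleCat.{u} R, P M → Module.Finite R M
  self_mem_perp : rightPerp P (ModuleCat.of R R)
  syzygy : ∀ (K F M : ModuleCat.{u} R) (f : K →ₗ[R] F) (g : F →ₗ[R] M), finFree R F →
    Function.Injective f → Function.Exact f g → Function.Surjective g → P M → P K
  dual : ∀ M : ModuleCat.{u} R, P M → P (ModuleCat.of R (Module.Dual R M))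

theorem IsReflexiveSubcategory.isSyzygyDualClosed {R : Type u} [CommRing R]
    {P : ObjectProperty (ModuleCat.{u} R)} (h : IsReflexiveSubcategory P) :
    IsSyzygyDualClosed P :=
  ⟨h.finite, h.self_mem_perp, h.syzygy, h.dual⟩

variable {R : Type u} [CommRing R] {P : ObjectProperty (ModuleCat.{u} R)}

namespace IsSyzygyDualClosed

variable (hP : IsSyzygyDualClosed P)

include hP

/-- The dual of a short exact sequence `0 → K → F → M → 0` with `M` in the class is exact. -/
theorem dualMap_surjective {K F M : ModuleCat.{u} R} {f : K →ₗ[R] F} {g : F →ₗ[R] M}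
    (hf : Function.Injective f) (hfg : Function.Exact f g) (hg : Function.Surjective g) (hM : P M) :
    Function.Surjective f.dualMap :=
  lcomp_surjective_of_subsingleton_ext_one hf hfg hg (hP.self_mem_perp.2 M hM 1 one_pos)

variable [IsNoetherianRing R]

/-- The cokernel of K* → F* is the dual of the syzygy, hence in the class. So a map K* → C extends
to F*, where it comes from F ⊗ C. -/
theorem tensorToHomDual_surjective {C K : ModuleCat.{u} R}
    (hC : ∀ X, P X → Subsingleton (Ext.{u} X C 1)) (hK : P K) :
    Function.Surjective (tensorToHomDual (R := R) K C) := by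
  have := hP.finite K hK
  obtain ⟨Ω, F, f, g, hF, hf, hfg, hg⟩ := exists_syzygy K
  have hΩ := hP.dual _ (hP.syzygy Ω F K f g hF hf hfg hg hK)
  intro h
  obtain ⟨h', hh'⟩ := exists_comp_eq_of_subsingleton_ext_one
    (LinearMap.dualMap_injective_of_surjective hg)
    (exact_lcomp_of_exact_of_surjective R hfg hg)
    (hP.dualMap_surjective hf hfg hg hK) (hC _ hΩ) h
  have := hF.1
  have := hF.2
  obtain ⟨t, rfl⟩ := (tensorToHomDual_bijective_of_free (R := R) (F := F) (C := C)).2 h'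
  exact ⟨g.rTensor C t, by rw [tensorToHomDual_rTensor, hh']⟩

/-- Diagram chase against the free cover F, using the bijection for F and surjectivity for the
syzygy. -/
theorem tensorToHomDual_injective {C K : ModuleCat.{u} R}
    (hC : ∀ X, P X → Subsingleton (Ext.{u} X C 1)) (hK : P K) :
    Function.Injective (tensorToHomDual (R := R) K C) := by
  have := hP.finite K hK
  obtain ⟨Ω, F, f, g, hF, hf, hfg, hg⟩ := exists_syzygy K
  have hΩ := hP.syzygy Ω F K f g hF hf hfg hg hK
  have := hF.1
  have := hF.2
  rw [injective_iff_map_eq_zero]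
  intro t ht
  obtain ⟨s, rfl⟩ := LinearMap.rTensor_surjective C hg t
  rw [tensorToHomDual_rTensor] at ht
  obtain ⟨h, hh⟩ := (exact_lcomp_of_exact_of_surjective C
    (exact_lcomp_of_exact_of_surjective R hfg hg)
    (hP.dualMap_surjective hf hfg hg hK) (tensorToHomDual F C s)).1 ht
  obtain ⟨w, rfl⟩ := hP.tensorToHomDual_surjective hC hΩ h
  have hs : f.rTensor C w = s :=
    (tensorToHomDual_bijective_of_free (R := R) (F := F) (C := C)).1
      ((tensorToHomDual_rTensor f w).trans hh)
  rw [← hs, ← LinearMap.comp_apply, ← LinearMap.rTensor_comp, hfg.linearMap_comp_eq_zero]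
  simp

/-- A syzygy of a module in the class stays embedded after tensoring with a module of the right
orthogonal. -/
theorem rTensor_injective {C K F M : ModuleCat.{u} R} {f : K →ₗ[R] F} {g : F →ₗ[R] M}
    (hC : ∀ X, P X → Subsingleton (Ext.{u} X C 1)) (hF : finFree R F)
    (hf : Function.Injective f) (hfg : Function.Exact f g) (hg : Function.Surjective g) (hM : P M) :
    Function.Injective (f.rTensor C) := by
  rw [injective_iff_map_eq_zero]
  intro t ht
  apply hP.tensorToHomDual_injective hC (hP.syzygy K F M f g hF hf hfg hg hM)
  rw [map_zero, ← LinearMap.cancel_right (hP.dualMap_surjective hf hfg hg hM),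
    ← tensorToHomDual_rTensor, ht, map_zero, LinearMap.zero_comp]

/-- Under K ⊗ C ≅ Hom(K*, C) this becomes left exactness of Hom. Nothing is required of C'. -/
theorem lTensor_injective {C C' K : ModuleCat.{u} R} {i : C →ₗ[R] C'} (hi : Function.Injective i)
    (hC : ∀ X, P X → Subsingleton (Ext.{u} X C 1)) (hK : P K) :
    Function.Injective (i.lTensor K) := by
  rw [injective_iff_map_eq_zero]
  intro t ht
  apply hP.tensorToHomDual_injective hC hK
  apply compRight_injective hi
  change i ∘ₗ tensorToHomDual K C t = i ∘ₗ tensorToHomDual K C 0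
  rw [← tensorToHomDual_lTensor, ht, map_zero, map_zero, LinearMap.comp_zero]

/-- This Ext is Hom(Tor_(n+1)(G, L), I), and the Tor vanishes because syzygies stay embedded after
tensoring with L. The proof avoids Tor by shifting along syzygies of G. -/
theorem subsingleton_ext_hom_injective {L I G : ModuleCat.{u} R}
    (hL : ∀ X, P X → Subsingleton (Ext.{u} X L 1)) (hI : Injective I) (hG : P G) (n : ℕ) :
    Subsingleton (Ext.{u} L (ModuleCat.of R (G →ₗ[R] I)) (n + 1)) := by
  have hI' : Module.Injective R I := Module.injective_module_of_injective_object R I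
  induction n generalizing G with
  | zero =>
    have := hP.finite G hG
    obtain ⟨Ω, F, f, g, hF, hf, hfg, hg⟩ := exists_syzygy G
    have := hF.2
    have hFI : Injective (ModuleCat.of R (F →ₗ[R] I)) :=
      @Module.injective_object_of_injective_module _ _ _ _ _ injective_hom_of_flat
    refine subsingleton_ext_one_of_compRight_surjective (lcomp_injective_of_surjective (N := I) g hg)
      (exact_lcomp_of_exact_of_surjective I hfg hg)
      (show Function.Surjective (f.lcomp R I) from
        fun φ => Module.Injective.extension_property R _ _ _ f hf φ) hFI fun y => ?_
    -- A map L → Hom(Ω, I) is a map Ω ⊗ L → I, which extends along Ω ⊗ L → F ⊗ L.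
    obtain ⟨h, hh⟩ := Module.Injective.out (f.rTensor L)
      (hP.rTensor_injective hL hF hf hfg hg hG) (TensorProduct.lift y.flip)
    refine ⟨(TensorProduct.curry h).flip, ?_⟩
    ext l x
    simpa using hh (x ⊗ₜ l)
  | succ n ih =>
    have := hP.finite G hG
    obtain ⟨Ω, F, f, g, hF, hf, hfg, hg⟩ := exists_syzygy G
    have := hF.2
    have hS := shortExact_of_linearMap (lcomp_injective_of_surjective (N := I) g hg)
      (exact_lcomp_of_exact_of_surjective I hfg hg)
      (show Function.Surjective (f.lcomp R I) from
        fun φ => Module.Injective.extension_property R _ _ _ f hf φ)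
    have hFI : Injective (ModuleCat.of R (F →ₗ[R] I)) :=
      @Module.injective_object_of_injective_module _ _ _ _ _ injective_hom_of_flat
    exact subsingleton_ext_to_X₁ hS (Ext.subsingleton_of_injective _ _ _)
      (ih (hP.syzygy Ω F G f g hF hf hfg hg hG))

end IsSyzygyDualClosed

end DualSyzygyClosed

/-! ### Consequences of minimality, by dimension shifting in C. -/

section MinimalDualStep

open TensorProduct Abelian LinearMap

variable {R : Type u} [CommRing R]

/-- The sequence `0 → Hom(G, C) → Hom(G, I) → Hom(G, D) → 0` induced by `0 → C → I → D → 0`. -/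
noncomputable abbrev homShortComplex (G : ModuleCat.{u} R) {C I D : ModuleCat.{u} R}
    {a : C →ₗ[R] I} {b : I →ₗ[R] D} (ha : Function.Injective a) (hab : Function.Exact a b) :
    ShortComplex (ModuleCat.{u} R) :=
  ModuleCat.shortComplexOfCompEqZero (a.compRight R : (G →ₗ[R] C) →ₗ[R] G →ₗ[R] I)
    (b.compRight R) (exact_compRight ha hab).linearMap_comp_eq_zero

theorem homShortComplex_shortExact {G C I D : ModuleCat.{u} R}
    {a : C →ₗ[R] I} {b : I →ₗ[R] D} (ha : Function.Injective a) (hab : Function.Exact a b)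
    (hb : Function.Surjective b) (h : Subsingleton (Ext.{u} G C 1)) :
    (homShortComplex G ha hab).ShortExact :=
  shortExact_of_linearMap (compRight_injective ha) (exact_compRight ha hab)
    (compRight_surjective_of_subsingleton_ext_one ha hab hb h)

/-- The morphism `Hom(G, C) ⟶ Hom(Q, C)` induced by `Q → G`. -/
noncomputable abbrev homPrecomp {Q G : ModuleCat.{u} R} (q : Q →ₗ[R] G) (C : ModuleCat.{u} R) :
    ModuleCat.of R (G →ₗ[R] C) ⟶ ModuleCat.of R (Q →ₗ[R] C) :=
  ModuleCat.ofHom (q.lcomp R C)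

theorem homShortComplex_extClass_naturality {Q G C I D : ModuleCat.{u} R} (q : Q →ₗ[R] G)
    {a : C →ₗ[R] I} {b : I →ₗ[R] D} (ha : Function.Injective a) (hab : Function.Exact a b)
    (hG : (homShortComplex G ha hab).ShortExact) (hQ : (homShortComplex Q ha hab).ShortExact) :
    hG.extClass.comp (Ext.mk₀ (homPrecomp q C)) (add_zero 1) =
      (Ext.mk₀ (homPrecomp q D)).comp hQ.extClass (zero_add 1) :=
  ShortComplex.ShortExact.extClass_naturality hG hQ
    { τ₁ := homPrecomp q C
      τ₂ := homPrecomp q I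
      τ₃ := homPrecomp q D }

theorem subsingleton_ext_of_finFree {Q : ModuleCat.{u} R} (hQ : finFree R Q) (C : ModuleCat.{u} R)
    {n : ℕ} (hn : 0 < n) : Subsingleton (Ext.{u} Q C n) := by
  obtain ⟨n, rfl⟩ := Nat.exists_eq_succ_of_ne_zero hn.ne'
  have : Module.Free R Q := hQ.2
  have : Module.Projective R Q := Module.Projective.of_free
  have : Projective Q := (IsProjective.iff_projective (R := R) (P := Q)).1 ‹_›
  exact Ext.subsingleton_of_projective Q C n

/-- The cosyzygy of a module right orthogonal to `G` is again right orthogonal to `G`. -/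
theorem subsingleton_ext_cosyzygy {G C I D : ModuleCat.{u} R} {a : C →ₗ[R] I} {b : I →ₗ[R] D}
    (hI : Injective I) (ha : Function.Injective a) (hab : Function.Exact a b)
    (hb : Function.Surjective b) (hC : ∀ i, 0 < i → Subsingleton (Ext.{u} G C i)) :
    ∀ i, 0 < i → Subsingleton (Ext.{u} G D i) := fun i hi => by
  obtain ⟨i, rfl⟩ := Nat.exists_eq_succ_of_ne_zero hi.ne'
  exact subsingleton_ext_to_X₃ (shortExact_of_linearMap ha hab hb)
    (Ext.subsingleton_of_injective _ I _) (hC _ (by lia))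

variable [IsLocalRing R] {Y Q G : ModuleCat.{u} R} {f : Y →ₗ[R] Q} {q : Q →ₗ[R] G}

local notation "κ" => ModuleCat.of R (IsLocalRing.ResidueField R)

/-- If `Q → G` is minimal, then `Ext^j(k, Hom(G, C)) → Ext^j(k, Hom(Q, C))` is surjective. -/
theorem exists_ext_residueField_comp_homPrecomp_eq (hQ : finFree R Q) (hfq : Function.Exact f q)
    (hq : Function.Surjective q) (hmin : range f ≤ IsLocalRing.maximalIdeal R • ⊤) (j : ℕ)
    (C : ModuleCat.{u} R) (hC : ∀ i, 0 < i → Subsingleton (Ext.{u} G C i))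
    (θ : Ext.{u} κ (ModuleCat.of R (Q →ₗ[R] C)) j) :
    ∃ η : Ext.{u} κ (ModuleCat.of R (G →ₗ[R] C)) j,
      η.comp (Ext.mk₀ (homPrecomp q C)) (add_zero j) = θ := by
  induction j generalizing C with
  | zero =>
    obtain ⟨θ, rfl⟩ := (Ext.mk₀_bijective _ _).2 θ
    -- The image of k is killed by 𝔪, so each map in it vanishes on 𝔪Q, which contains the kernel of
    -- q.
    have hθ : ∀ x, θ.hom x ∈ range (q.lcomp R C) := fun x => by
      refine (exact_lcomp_of_exact_of_surjective C hfq hq _).1 ?_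
      ext y
      have hle : IsLocalRing.maximalIdeal R • ⊤ ≤ ker (θ.hom x : Q →ₗ[R] C) := by
        rw [Submodule.smul_le]
        intro r hr p _
        obtain ⟨x, rfl⟩ := IsLocalRing.residue_surjective x
        have h0 : r • (IsLocalRing.residue R x) = 0 := by
          rw [Algebra.smul_def]
          change IsLocalRing.residue R r * _ = 0
          rw [(IsLocalRing.residue_eq_zero_iff r).2 hr, zero_mul]
        have := congrArg θ.hom h0
        rw [map_smul, map_zero] at this
        rw [mem_ker, map_smul]
        exact LinearMap.congr_fun this p
      exact hle (hmin ⟨y, rfl⟩)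
    refine ⟨Ext.mk₀ (ModuleCat.ofHom (codRestrictOfInjective θ.hom _
      (lcomp_injective_of_surjective (N := C) q hq) hθ)), ?_⟩
    rw [Ext.mk₀_comp_mk₀]
    congr 1
    ext x : 2
    exact codRestrictOfInjective_comp_apply θ.hom (q.lcomp R C) _ hθ x
  | succ j ih =>
    obtain ⟨I, D, a, b, hI, ha, hab, hb⟩ := exists_injective_shortExact C
    have hGS := homShortComplex_shortExact ha hab hb (hC 1 one_pos)
    have hQS := homShortComplex_shortExact ha hab hb (subsingleton_ext_of_finFree hQ C one_pos)
    have := hQ.2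
    have hI' : Module.Injective R I := Module.injective_module_of_injective_object R I
    have hQI : Injective (ModuleCat.of R (Q →ₗ[R] I)) :=
      @Module.injective_object_of_injective_module _ _ _ _ _ injective_hom_of_flat
    -- As Hom(Q, I) is injective, θ is a connecting image from the cosyzygy D, one degree lower.
    obtain ⟨θ', rfl⟩ := Ext.covariant_sequence_exact₁ _ hQS θ
      (@Ext.eq_zero_of_injective _ _ _ _ _ _ _ hQI _) rfl
    obtain ⟨η, rfl⟩ := ih D (subsingleton_ext_cosyzygy hI ha hab hb hC) θ'
    refine ⟨η.comp hGS.extClass rfl, ?_⟩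
    rw [Ext.comp_assoc_of_third_deg_zero, homShortComplex_extClass_naturality q ha hab hGS hQS,
      Ext.comp_assoc_of_second_deg_zero]

variable {L B : ModuleCat.{u} R} {i : L →ₗ[R] B} {π : B →ₗ[R] IsLocalRing.ResidueField R}
  (hi : Function.Injective i) (hiπ : Function.Exact i π) (hπ : Function.Surjective π)

-- Since 𝔪 kills k, 𝔪B lies in the image of L; scalars from 𝔪 move across the tensor sign.
include hiπ in
theorem tmul_mem_range_lTensor {p : Q} (hp : p ∈ (IsLocalRing.maximalIdeal R • ⊤ : Submodule R Q))
    (b : B) : p ⊗ₜ[R] b ∈ range (i.lTensor Q) := by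
  have hle : IsLocalRing.maximalIdeal R • ⊤ ≤
      (range (i.lTensor Q)).comap ((TensorProduct.mk R Q B).flip b) := by
    rw [Submodule.smul_le]
    intro r hr p _
    obtain ⟨l, hl⟩ : r • b ∈ range i := (hiπ _).1 (by
      rw [map_smul, Algebra.smul_def]
      change IsLocalRing.residue R r * _ = 0
      rw [(IsLocalRing.residue_eq_zero_iff r).2 hr, zero_mul])
    exact ⟨p ⊗ₜ l, by simp [hl]⟩
  exact hle hp

/-- If `Q → G` is minimal and a homomorphism `L → Hom(G, C)` extends to `B` after composing with
`Hom(G, C) → Hom(Q, C)`, then it extends to `B`. -/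
theorem exists_extension_of_extension_homPrecomp
    (hiπ : Function.Exact i π) (hfq : Function.Exact f q)
    (hq : Function.Surjective q) (hmin : range f ≤ IsLocalRing.maximalIdeal R • ⊤)
    (hG : Function.Injective (i.lTensor G)) {C : ModuleCat.{u} R} (u : L →ₗ[R] G →ₗ[R] C)
    (v : B →ₗ[R] Q →ₗ[R] C) (huv : v ∘ₗ i = q.lcomp R C ∘ₗ u) :
    ∃ w : B →ₗ[R] G →ₗ[R] C, w ∘ₗ i = u := by
  have hUV : TensorProduct.lift v.flip ∘ₗ i.lTensor Q =
      TensorProduct.lift u.flip ∘ₗ q.rTensor L := by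
    ext p l
    exact LinearMap.congr_fun (LinearMap.congr_fun huv l) p
  -- It must be shown that v(b) vanishes on f(y). The tensor f(y) ⊗ b lifts to t in Q ⊗ L. The image
  -- of t in G ⊗ B is zero, hence so is its image in G ⊗ L, through which the value factors.
  have hv : ∀ b, v b ∈ range (q.lcomp R C) := fun b => by
    refine (exact_lcomp_of_exact_of_surjective C hfq hq _).1 ?_
    ext y
    obtain ⟨t, ht⟩ := tmul_mem_range_lTensor hiπ (hmin ⟨y, rfl⟩) b
    have h0 : q.rTensor L t = 0 := hG (by
      rw [map_zero, ← LinearMap.comp_apply, LinearMap.lTensor_comp_rTensor,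
        ← LinearMap.rTensor_comp_lTensor, LinearMap.comp_apply, ht, rTensor_tmul,
        hfq.apply_apply_eq_zero, zero_tmul])
    have := LinearMap.congr_fun hUV t
    rw [LinearMap.comp_apply, LinearMap.comp_apply, ht, h0, map_zero] at this
    exact this
  have hinj : Function.Injective (q.lcomp R C) := lcomp_injective_of_surjective q hq
  refine ⟨codRestrictOfInjective v _ hinj hv, ?_⟩
  ext l : 1
  apply hinj
  rw [LinearMap.comp_apply, codRestrictOfInjective_comp_apply]
  exact LinearMap.congr_fun huv l

/-- If `Q → G` is minimal, then an element in the image of the connecting map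
`Ext^j(L, Hom(G, C)) → Ext^(j+1)(k, Hom(G, C))` that vanishes in `Ext^(j+1)(k, Hom(Q, C))` is
zero. -/
theorem extClass_comp_eq_zero_of_comp_homPrecomp_eq_zero (hQ : finFree R Q)
    (hfq : Function.Exact f q) (hq : Function.Surjective q)
    (hmin : range f ≤ IsLocalRing.maximalIdeal R • ⊤) (hG : Function.Injective (i.lTensor G))
    (hL : ∀ I : ModuleCat.{u} R, Injective I → ∀ n : ℕ,
      Subsingleton (Ext.{u} L (ModuleCat.of R (G →ₗ[R] I)) (n + 1)))
    (j : ℕ) (C : ModuleCat.{u} R) (hC : ∀ i, 0 < i → Subsingleton (Ext.{u} G C i))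
    (ζ : Ext.{u} L (ModuleCat.of R (G →ₗ[R] C)) j)
    (hζ : ((shortExact_of_linearMap hi hiπ hπ).extClass.comp ζ (add_comm 1 j)).comp
      (Ext.mk₀ (homPrecomp q C)) (add_zero _) = 0) :
    (shortExact_of_linearMap hi hiπ hπ).extClass.comp ζ (add_comm 1 j) = 0 := by
  have hS := shortExact_of_linearMap hi hiπ hπ
  induction j generalizing C with
  | zero =>
    obtain ⟨ζ, rfl⟩ := (Ext.mk₀_bijective _ _).2 ζ
    rw [Ext.comp_assoc_of_third_deg_zero, Ext.mk₀_comp_mk₀] at hζ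
    -- In degree zero, the connecting image of a map on L vanishes exactly when the map extends to
    -- B.
    obtain ⟨v, hv⟩ := Ext.contravariant_sequence_exact₁ hS _ _ (add_zero 1) hζ
    obtain ⟨v, rfl⟩ := (Ext.mk₀_bijective _ _).2 v
    rw [Ext.mk₀_comp_mk₀] at hv
    have hv := ModuleCat.hom_ext_iff.1 ((Ext.mk₀_bijective _ _).1 hv)
    obtain ⟨w, hw⟩ := exists_extension_of_extension_homPrecomp hiπ hfq hq hmin hG
      ζ.hom v.hom hv
    have hζw : ζ = ModuleCat.ofHom i ≫ ModuleCat.ofHom w := ModuleCat.hom_ext hw.symm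
    rw [hζw, ← Ext.mk₀_comp_mk₀]
    exact hS.extClass_comp_assoc _
  | succ j ih =>
    obtain ⟨I, D, a, b, hI, ha, hab, hb⟩ := exists_injective_shortExact C
    have hGS := homShortComplex_shortExact ha hab hb (hC 1 one_pos)
    have hQS := homShortComplex_shortExact ha hab hb (subsingleton_ext_of_finFree hQ C one_pos)
    have := hQ.2
    have hI' : Module.Injective R I := Module.injective_module_of_injective_object R I
    have hQI : Injective (ModuleCat.of R (Q →ₗ[R] I)) :=
      @Module.injective_object_of_injective_module _ _ _ _ _ injective_hom_of_flat
    obtain ⟨ζ', rfl⟩ := Ext.covariant_sequence_exact₁ _ hGS ζ ((hL I hI j).elim _ _) rfl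
    rw [← Ext.comp_assoc _ _ _ (add_comm 1 j) rfl (by lia)] at hζ ⊢
    rw [ih D (subsingleton_ext_cosyzygy hI ha hab hb hC) ζ' ?_, Ext.zero_comp]
    rw [Ext.comp_assoc_of_third_deg_zero, homShortComplex_extClass_naturality q ha hab hGS hQS,
      ← Ext.comp_assoc_of_second_deg_zero] at hζ
    -- The connecting map out of Ext^(1+j)(k, Hom(Q, D)) is injective: Hom(Q, I) is injective and
    -- the degree is positive.
    obtain ⟨x, hx⟩ := Ext.covariant_sequence_exact₃ _ hQS _ _ hζ
    rw [← hx, @Ext.eq_zero_of_injective _ _ _ _ _ _ _ hQI x, Ext.zero_comp]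

end MinimalDualStep

/-! ### Comparison of Ext(k, -) with Ext(B, -), and stable modules. -/

section Approximation

open TensorProduct Abelian LinearMap

variable {R : Type u} [CommRing R]

/-- R is a retract of Q*, through one basis vector and its coordinate. -/
theorem subsingleton_ext_self_of_finFree {Q X : ModuleCat.{u} R} (hQ : finFree R Q) [Nontrivial Q]
    {n : ℕ} (h : Subsingleton (Ext.{u} X (ModuleCat.of R (Q →ₗ[R] R)) n)) :
    Subsingleton (Ext.{u} X (ModuleCat.of R R) n) := by
  have := hQ.2
  let b := Module.Free.chooseBasis R Q
  obtain ⟨e⟩ := b.index_nonempty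
  refine subsingleton_ext_to_of_retract
    { i := ModuleCat.ofHom (LinearMap.toSpanSingleton R _ (b.coord e))
      r := ModuleCat.ofHom (LinearMap.applyₗ (b e))
      retract := ?_ } h
  ext
  simp

variable [IsLocalRing R]

local notation "κ" => ModuleCat.of R (IsLocalRing.ResidueField R)

/-- If `k` is the cokernel of `i : L → B` and `0 → Y → Q → G → 0` is a minimal sequence that stays
exact under duality, then `Ext^j(k, Y*) → Ext^j(B, Y*)` is injective. -/
theorem eq_zero_of_residueField_precomp_eq_zero {Y Q G : ModuleCat.{u} R} {f : Y →ₗ[R] Q}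
    {q : Q →ₗ[R] G} (hQ : finFree R Q)
    (hfq : Function.Exact f q) (hq : Function.Surjective q)
    (hf : Function.Surjective (f.lcomp R R))
    (hmin : range f ≤ IsLocalRing.maximalIdeal R • ⊤)
    {L B : ModuleCat.{u} R} {i : L →ₗ[R] B} {π : B →ₗ[R] IsLocalRing.ResidueField R}
    (hi : Function.Injective i) (hiπ : Function.Exact i π) (hπ : Function.Surjective π)
    (hG : Function.Injective (i.lTensor G))
    (hGR : ∀ i, 0 < i → Subsingleton (Ext.{u} G (ModuleCat.of R R) i))
    (hL : ∀ I : ModuleCat.{u} R, Injective I → ∀ n : ℕ,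
      Subsingleton (Ext.{u} L (ModuleCat.of R (G →ₗ[R] I)) (n + 1)))
    (j : ℕ) (η : Ext.{u} κ (ModuleCat.of R (Y →ₗ[R] R)) j)
    (hη : (Ext.mk₀ (ModuleCat.ofHom π)).comp η (zero_add j) = 0) : η = 0 := by
  have hD := shortExact_of_linearMap (lcomp_injective_of_surjective (N := R) q hq)
    (exact_lcomp_of_exact_of_surjective R hfq hq) hf
  have hS := shortExact_of_linearMap hi hiπ hπ
  -- The connecting image of η in Ext^(j+1)(k, G*) dies over B, so it comes from L; it also dies in
  -- Ext^(j+1)(k, Q*).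
  have h0 : η.comp hD.extClass rfl = 0 := by
    obtain ⟨ζ, hζ⟩ := Ext.contravariant_sequence_exact₃ hS _ (η.comp hD.extClass rfl)
      (by
        rw [← Ext.comp_assoc _ _ _ (zero_add j) rfl (by lia)]
        erw [hη]
        rw [Ext.zero_comp]) (add_comm 1 j)
    rw [← hζ]
    refine extClass_comp_eq_zero_of_comp_homPrecomp_eq_zero hi hiπ hπ hQ hfq hq hmin hG hL j
      (ModuleCat.of R R) hGR ζ ?_
    erw [hζ]
    rw [Ext.comp_assoc_of_third_deg_zero]
    erw [hD.extClass_comp]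
    rw [Ext.comp_zero]
  -- Thus η comes from Ext^j(k, Q*), and therefore from Ext^j(k, G*); the composite G* → Q* → Y* is
  -- zero.
  obtain ⟨θ, hθ⟩ := Ext.covariant_sequence_exact₃ _ hD η rfl h0
  obtain ⟨ξ, hξ⟩ := exists_ext_residueField_comp_homPrecomp_eq hQ hfq hq hmin j
    (ModuleCat.of R R) hGR θ
  rw [← hθ, ← hξ, Ext.comp_assoc_of_second_deg_zero]
  erw [ShortComplex.ext_mk₀_f_comp_ext_mk₀_g (ModuleCat.shortComplexOfCompEqZero (q.lcomp R R)
    (f.lcomp R R) (exact_lcomp_of_exact_of_surjective R hfq hq).linearMap_comp_eq_zero)]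
  rw [Ext.comp_zero]

/-- The relation between the duals `Y` of a module and `G` of its minimal first syzygy. -/
def IsMinimalCosyzygy (Y G : ModuleCat.{u} R) : Prop :=
  ∃ (Q : ModuleCat.{u} R) (f : Y →ₗ[R] Q) (q : Q →ₗ[R] G), finFree R Q ∧ Nontrivial Q ∧
    Function.Exact f q ∧ Function.Surjective q ∧ Function.Surjective (f.lcomp R R) ∧
    range f ≤ IsLocalRing.maximalIdeal R • ⊤

/-- A nonzero module in `P` without nonzero free direct summand. -/
structure IsStable (P : ObjectProperty (ModuleCat.{u} R)) (X : ModuleCat.{u} R) : Prop where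
  prop : P X
  nontrivial : Nontrivial X
  mem_maximalIdeal : ∀ (φ : X →ₗ[R] R) (x : X), φ x ∈ IsLocalRing.maximalIdeal R

theorem IsStable.not_free {P : ObjectProperty (ModuleCat.{u} R)} {X : ModuleCat.{u} R}
    (h : IsStable P X) : ¬ Module.Free R X := fun _ => by
  have := h.nontrivial
  let b := Module.Free.chooseBasis R X
  obtain ⟨e⟩ := b.index_nonempty
  refine (IsLocalRing.maximalIdeal.isMaximal R).ne_top ((Ideal.eq_top_iff_one _).2 ?_)
  simpa using h.mem_maximalIdeal (b.coord e) (b e)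

variable {P : ObjectProperty (ModuleCat.{u} R)}

namespace IsSyzygyDualClosed

variable (hP : IsSyzygyDualClosed P)

include hP

/-- If K were zero, X would be free. Functionals on K extend to F because Ext^1(X, R) = 0, and K
sits inside 𝔪F. -/
theorem isStable_syzygy {K F X : ModuleCat.{u} R} {f : K →ₗ[R] F} {g : F →ₗ[R] X}
    (hF : finFree R F) (hf : Function.Injective f) (hfg : Function.Exact f g)
    (hg : Function.Surjective g) (hmin : range f ≤ IsLocalRing.maximalIdeal R • ⊤) (hX : P X)
    (hfree : ¬ Module.Free R X) : IsStable P K where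
  prop := hP.syzygy K F X f g hF hf hfg hg hX
  nontrivial := by
    by_contra hK
    rw [not_nontrivial_iff_subsingleton] at hK
    have hg' : Function.Injective g := by
      rw [← LinearMap.ker_eq_bot, hfg.linearMap_ker_eq, LinearMap.range_eq_bot]
      exact LinearMap.ext fun x => by rw [Subsingleton.elim x 0, map_zero, map_zero]
    have := hF.2
    exact hfree (Module.Free.of_equiv (LinearEquiv.ofBijective g ⟨hg', hg⟩))
  mem_maximalIdeal φ x := by
    obtain ⟨ψ, rfl⟩ := hP.dualMap_surjective hf hfg hg hX φ
    have hle : IsLocalRing.maximalIdeal R • ⊤ ≤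
        Submodule.comap ψ (IsLocalRing.maximalIdeal R) := by
      rw [Submodule.smul_le]
      intro r hr p _
      rw [Submodule.mem_comap, map_smul]
      exact Ideal.mul_mem_right _ _ hr
    exact hle (hmin ⟨x, rfl⟩)

/-- Dualize a minimal cover F → X. Stability of X, not minimality of the cover, puts X* inside 𝔪F*;
minimality makes the syzygy stable again, so the construction iterates. -/
theorem exists_isStable_isMinimalCosyzygy [IsNoetherianRing R] {X : ModuleCat.{u} R}
    (hX : IsStable P X) :
    ∃ X' : ModuleCat.{u} R, IsStable P X' ∧
      IsMinimalCosyzygy (ModuleCat.of R (Module.Dual R X)) (ModuleCat.of R (Module.Dual R X')) := by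
  have := hP.finite X hX.prop
  obtain ⟨K, F, f, g, hF, hf, hfg, hg, hmin⟩ := exists_minimal_syzygy X
  have hK := hP.isStable_syzygy hF hf hfg hg hmin hX.prop hX.not_free
  have := hF.1
  have := hF.2
  have := hX.nontrivial
  have : Nontrivial F := hg.nontrivial
  have hK' := hP.dual K hK.prop
  refine ⟨K, hK, ModuleCat.of R (Module.Dual R F), g.dualMap, f.dualMap,
    ⟨inferInstanceAs (Module.Finite R (Module.Dual R F)),
      inferInstanceAs (Module.Free R (Module.Dual R F))⟩,
    inferInstanceAs (Nontrivial (Module.Dual R F)),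
    exact_lcomp_of_exact_of_surjective R hfg hg, hP.dualMap_surjective hf hfg hg hX.prop,
    lcomp_surjective_of_subsingleton_ext_one (LinearMap.dualMap_injective_of_surjective hg)
      (exact_lcomp_of_exact_of_surjective R hfg hg) (hP.dualMap_surjective hf hfg hg hX.prop)
      (hP.self_mem_perp.2 _ hK' 1 one_pos), ?_⟩
  · rintro _ ⟨φ, rfl⟩
    rw [← (Module.Free.chooseBasis R F).sum_dual_apply_smul_coord (g.dualMap φ)]
    exact Submodule.sum_mem _ fun e _ => Submodule.smul_mem_smul (hX.mem_maximalIdeal φ _) trivial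

end IsSyzygyDualClosed

end Approximation

/-! ### The noetherian argument: vanishing of Bass numbers. -/

section Approximation

open TensorProduct Abelian LinearMap

variable {R : Type u} [CommRing R]

theorem subsingleton_ext_to_finFree {X F : ModuleCat.{u} R} (hF : finFree R F) {n : ℕ}
    (h : Subsingleton (Ext.{u} X (ModuleCat.of R R) n)) : Subsingleton (Ext.{u} X F n) := by
  have := hF.1
  have := hF.2
  let b := Module.Free.chooseBasis R F
  have hid : ∑ e, ModuleCat.ofHom (b.coord e) ≫ ModuleCat.ofHom (toSpanSingleton R F (b e)) =
      𝟙 F := by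
    ext x
    rw [ModuleCat.hom_sum, LinearMap.sum_apply]
    simp [b.sum_repr]
  refine subsingleton_of_forall_eq 0 fun x => ?_
  rw [← x.comp_mk₀_id, ← hid, Ext.mk₀_sum, Ext.comp_sum]
  refine Finset.sum_eq_zero fun e _ => ?_
  rw [← Ext.mk₀_comp_mk₀, ← Ext.comp_assoc_of_second_deg_zero, h.elim (x.comp _ _) 0,
    Ext.zero_comp]

variable [IsLocalRing R] [IsNoetherianRing R] {P : ObjectProperty (ModuleCat.{u} R)}

local notation "κ" => ModuleCat.of R (IsLocalRing.ResidueField R)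

namespace IsSyzygyDualClosed

variable (hP : IsSyzygyDualClosed P)

include hP

/-- If `k` is approximated by the class and there is an infinite sequence of minimal cosyzygies in
it, then the Bass numbers of the ring vanish in large degrees. -/
theorem exists_subsingleton_ext_residueField {L B : ModuleCat.{u} R} (hL : rightPerp P L)
    (hB : P B) {i : L →ₗ[R] B} {π : B →ₗ[R] IsLocalRing.ResidueField R}
    (hi : Function.Injective i) (hiπ : Function.Exact i π) (hπ : Function.Surjective π)
    (Y : ℕ → ModuleCat.{u} R) (hY : ∀ n, P (Y n)) (hYY : ∀ n, IsMinimalCosyzygy (Y n) (Y (n + 1))) :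
    ∃ N : ℕ, ∀ m, N < m → Subsingleton (Ext.{u} κ (ModuleCat.of R R) m) := by
  choose Q f q hQ hQn hfq hq hf hmin using hYY
  have := hP.finite B hB
  let D : ℕ → ModuleCat.{u} R := fun n => ModuleCat.of R (Y n →ₗ[R] R)
  have hD : ∀ n, (ModuleCat.shortComplexOfCompEqZero ((q n).lcomp R R) ((f n).lcomp R R)
      (exact_lcomp_of_exact_of_surjective R (hfq n) (hq n)).linearMap_comp_eq_zero).ShortExact :=
    fun n => shortExact_of_linearMap (lcomp_injective_of_surjective (N := R) (q n) (hq n))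
      (exact_lcomp_of_exact_of_surjective R (hfq n) (hq n)) (hf n)
  let ε : ∀ n, Ext.{u} (D n) (D (n + 1)) 1 := fun n => (hD n).extClass
  let δ : ∀ n, Ext.{u} B (D n) (n + 1) →ₗ[R] Ext.{u} B (D (n + 1)) (n + 1 + 1) := fun n =>
    (ε n).postcompOfLinear R B rfl
  have hQfree : ∀ n, finFree R (ModuleCat.of R (Q n →ₗ[R] R)) := fun n => by
    have := (hQ n).1
    have := (hQ n).2
    exact ⟨inferInstanceAs (Module.Finite R (Module.Dual R (Q n))),
      inferInstanceAs (Module.Free R (Module.Dual R (Q n)))⟩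
  have hδ : ∀ n, Function.Surjective (δ n) := fun n x => Ext.covariant_sequence_exact₁ B (hD n) x
    ((subsingleton_ext_to_finFree (hQfree n) (hP.self_mem_perp.2 B hB _ (by lia))).elim _ _) rfl
  -- Iterated connecting maps, surjective because Ext(B, Q_n*) vanishes in positive degrees.
  let Φ : ∀ n : ℕ, Ext.{u} B (D 0) 1 →ₗ[R] Ext.{u} B (D n) (n + 1) := fun n =>
    Nat.rec LinearMap.id (fun n φ => δ n ∘ₗ φ) n
  have hΦ : ∀ n, Function.Surjective (Φ n) := fun n => by
    induction n with
    | zero => exact Function.surjective_id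
    | succ n ih => exact (hδ n).comp ih
  have hΦδ : ∀ n v, Φ (n + 1) v = δ n (Φ n v) := fun _ _ => rfl
  let p : ∀ n, Ext.{u} κ (D n) (n + 1) →ₗ[R] Ext.{u} B (D n) (n + 1) := fun n =>
    (Ext.mk₀ (ModuleCat.ofHom π : B ⟶ κ)).precompOfLinear R (D n) (zero_add (n + 1))
  have hpδ : ∀ n (η : Ext.{u} κ (D n) (n + 1)), δ n (p n η) = p (n + 1) (η.comp (ε n) rfl) :=
    fun n η => Ext.comp_assoc _ _ _ (zero_add (n + 1)) rfl (by lia)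
  have hp : ∀ n, Function.Injective (p n) := fun n => by
    rw [injective_iff_map_eq_zero]
    exact fun η hη => eq_zero_of_residueField_precomp_eq_zero (hQ n) (hfq n) (hq n) (hf n)
      (hmin n) hi hiπ hπ (hP.lTensor_injective hi (fun X hX => hL.2 X hX 1 one_pos) (hY (n + 1)))
      (fun j hj => hP.self_mem_perp.2 _ (hY (n + 1)) j hj)
      (fun I hI j => hP.subsingleton_ext_hom_injective (fun X hX => hL.2 X hX 1 one_pos) hI
        (hY (n + 1)) j) (n + 1) η hη
  -- The images of Ext(k, -) compared inside one noetherian module; they ascend because the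
  -- connecting maps commute with restriction along π.
  let V : ℕ →o Submodule R (Ext.{u} B (D 0) 1) :=
    ⟨fun n => (range (p n)).comap (Φ n), monotone_nat_of_le_succ fun n v => by
      rintro ⟨η, hη⟩
      exact ⟨η.comp (ε n) rfl, by rw [hΦδ, ← hη, hpδ]⟩⟩
  have hfin : Module.Finite R (D 0) := hP.finite _ (hP.dual _ (hY 0))
  obtain ⟨N, hN⟩ := monotone_stabilizes_iff_noetherian.2
    (inferInstanceAs (IsNoetherian R (Ext.{u} B (D 0) 1))) V
  refine ⟨N + 1, fun m hm => ?_⟩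
  obtain ⟨m, rfl⟩ := Nat.exists_eq_add_of_lt hm
  obtain ⟨n, hn, hnm⟩ : ∃ n, N ≤ n ∧ N + 1 + m + 1 = n + 1 + 1 := ⟨N + m, by lia, by lia⟩
  rw [hnm]
  have := hQn n
  refine subsingleton_ext_self_of_finFree (hQ n) (subsingleton_of_forall_eq 0 fun θ => ?_)
  obtain ⟨η, rfl⟩ := exists_ext_residueField_comp_homPrecomp_eq (hQ n) (hfq n) (hq n) (hmin n)
    (n + 1 + 1) (ModuleCat.of R R) (fun j hj => hP.self_mem_perp.2 _ (hY (n + 1)) j hj) θ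
  obtain ⟨v, hv⟩ := hΦ (n + 1) (p (n + 1) η)
  have hvV : v ∈ V (n + 1) := ⟨η, hv.symm⟩
  rw [← hN (n + 1) (by lia), hN n hn] at hvV
  obtain ⟨η', hη'⟩ := hvV
  -- Stabilization makes η a connecting image, so it dies in Ext(k, Q_n*).
  have hη : η = η'.comp (ε n) rfl := hp (n + 1) (by rw [← hpδ, hη', ← hΦδ, hv])
  rw [hη, Ext.comp_assoc_of_third_deg_zero]
  erw [(hD n).extClass_comp]
  rw [Ext.comp_zero]

/-- If `k` is approximated by a class that contains a module that is not free, then the ring is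
Gorenstein. -/
theorem isGorensteinLocal {L B : ModuleCat.{u} R} (hL : rightPerp P L)
    (hB : P B) {i : L →ₗ[R] B} {π : B →ₗ[R] IsLocalRing.ResidueField R}
    (hi : Function.Injective i) (hiπ : Function.Exact i π) (hπ : Function.Surjective π)
    {X : ModuleCat.{u} R} (hX : P X) (hfree : ¬ Module.Free R X) : IsGorensteinLocal R := by
  have := hP.finite X hX
  obtain ⟨K, F, f, g, hF, hf, hfg, hg, hmin⟩ := exists_minimal_syzygy X
  have hK := hP.isStable_syzygy hF hf hfg hg hmin hX hfree
  choose s hs hs' using fun X : {X // IsStable P X} => hP.exists_isStable_isMinimalCosyzygy X.2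
  let Z : ℕ → {X // IsStable P X} := fun n => Nat.rec ⟨K, hK⟩ (fun _ X => ⟨s X, hs X⟩) n
  obtain ⟨N, hN⟩ := hP.exists_subsingleton_ext_residueField hL hB hi hiπ hπ
    (fun n => ModuleCat.of R (Module.Dual R (Z n).1)) (fun n => hP.dual _ (Z n).2.prop)
    (fun n => hs' (Z n))
  exact isGorensteinLocal_of_subsingleton_ext N hN

end IsSyzygyDualClosed

end Approximation

/-! ### Syzygies, duals and Ext vanishing for totally reflexive modules. -/

section TotallyReflexive

open Abelian LinearMap

variable {R : Type u} [CommRing R]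

/-- Totally acyclic complexes of finitely generated free modules. -/
structure IsTotallyAcyclic (F : ChainComplex (ModuleCat.{u} R) ℤ) : Prop where
  finFree : ∀ n, finFree R (F.X n)
  exact : ∀ a b c, b + 1 = a → c + 1 = b → Function.Exact (F.d a b).hom (F.d b c).hom
  dual_exact : ∀ a b c, b + 1 = a → c + 1 = b →
    Function.Exact (F.d b c).hom.dualMap (F.d a b).hom.dualMap

/-- The complex `F` with degrees shifted by `s`. -/
def shiftComplex (F : ChainComplex (ModuleCat.{u} R) ℤ) (s : ℤ) :
    ChainComplex (ModuleCat.{u} R) ℤ where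
  X n := F.X (n + s)
  d i j := F.d (i + s) (j + s)
  shape i j h := F.shape _ _ fun h' => h (by simp only [ComplexShape.down_Rel] at h' ⊢; lia)
  d_comp_d' _ _ _ _ _ := F.d_comp_d _ _ _

/-- The dual complex, reindexed as a chain complex. -/
noncomputable def dualComplex (F : ChainComplex (ModuleCat.{u} R) ℤ) :
    ChainComplex (ModuleCat.{u} R) ℤ where
  X n := ModuleCat.of R (Module.Dual R (F.X (-n)))
  d i j := ModuleCat.ofHom (F.d (-j) (-i)).hom.dualMap
  shape i j h := by
    rw [F.shape _ _ fun h' => h (by simp only [ComplexShape.down_Rel] at h' ⊢; lia)]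
    ext
    simp
  d_comp_d' i j k _ _ := by
    ext φ x
    have : (F.d (-j) (-i)).hom ((F.d (-k) (-j)).hom x) = 0 := by
      rw [← ModuleCat.comp_apply, F.d_comp_d]
      rfl
    change φ ((F.d (-j) (-i)).hom ((F.d (-k) (-j)).hom x)) = 0
    rw [this, map_zero]

theorem exact_dualMap_dualMap {A B C : Type u} [AddCommGroup A] [AddCommGroup B] [AddCommGroup C]
    [Module R A] [Module R B] [Module R C] [Module.Finite R A] [Module.Finite R B]
    [Module.Finite R C] [Module.Free R A] [Module.Free R B] [Module.Free R C]
    {f : A →ₗ[R] B} {g : B →ₗ[R] C} (h : Function.Exact f g) :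
    Function.Exact f.dualMap.dualMap g.dualMap.dualMap := by
  refine Function.Exact.of_ladder_linearEquiv_of_exact (e₁ := Module.evalEquiv R A)
    (e₂ := Module.evalEquiv R B) (e₃ := Module.evalEquiv R C) ?_ ?_ h
  · ext x φ
    simp
  · ext x φ
    simp

namespace IsTotallyAcyclic

variable {F : ChainComplex (ModuleCat.{u} R) ℤ}

theorem shift (hF : IsTotallyAcyclic F) (s : ℤ) : IsTotallyAcyclic (shiftComplex F s) where
  finFree n := hF.finFree _
  exact a b c hab hbc := hF.exact _ _ _ (by lia) (by lia)
  dual_exact a b c hab hbc := hF.dual_exact _ _ _ (by lia) (by lia)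

theorem dual (hF : IsTotallyAcyclic F) : IsTotallyAcyclic (dualComplex F) where
  finFree n := by
    have := (hF.finFree (-n)).1
    have := (hF.finFree (-n)).2
    exact ⟨inferInstanceAs (Module.Finite R (Module.Dual R (F.X (-n)))),
      inferInstanceAs (Module.Free R (Module.Dual R (F.X (-n))))⟩
  exact a b c hab hbc := hF.dual_exact _ _ _ (by lia) (by lia)
  dual_exact a b c hab hbc := by
    have := (hF.finFree (-a)).1
    have := (hF.finFree (-a)).2
    have := (hF.finFree (-b)).1
    have := (hF.finFree (-b)).2
    have := (hF.finFree (-c)).1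
    have := (hF.finFree (-c)).2
    exact exact_dualMap_dualMap (hF.exact (-c) (-b) (-a) (by lia) (by lia))

theorem totallyReflexive_of_exact (hF : IsTotallyAcyclic F) {a b : ℤ} (hab : b + 1 = a)
    {M : ModuleCat.{u} R} {g : F.X b →ₗ[R] M} (hg : Function.Exact (F.d a b).hom g)
    (hg' : Function.Surjective g) : totallyReflexive R M := by
  obtain ⟨s, rfl⟩ : ∃ s, b = -1 + s := ⟨b + 1, by lia⟩
  obtain rfl : 0 + s = a := by lia
  exact ⟨shiftComplex F s, (hF.shift s).finFree,
    fun n => (hF.shift s).exact _ _ _ rfl (by lia),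
    fun n => (hF.shift s).dual_exact _ _ _ rfl (by lia),
    ⟨(hg.linearEquivOfSurjective hg').symm⟩⟩

/-- The image of a differential is the cokernel of the preceding one. -/
theorem totallyReflexive_of_range_eq (hF : IsTotallyAcyclic F) {b c : ℤ} (hbc : c + 1 = b)
    {M : ModuleCat.{u} R} {h : M →ₗ[R] F.X c} (hh : Function.Injective h)
    (hr : range h = range (F.d b c).hom) : totallyReflexive R M := by
  have hmem : ∀ x, (F.d b c).hom x ∈ range h := fun x => hr ▸ mem_range_self _ x
  have hc := codRestrictOfInjective_comp_apply (F.d b c).hom h hh hmem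
  refine hF.totallyReflexive_of_exact rfl
    (g := codRestrictOfInjective (F.d b c).hom h hh hmem) (fun x => ?_) fun y => ?_
  · rw [← hF.exact (b + 1) b c rfl hbc x, ← hc, map_eq_zero_iff h hh]
  · obtain ⟨x, hx⟩ : h y ∈ range (F.d b c).hom := hr ▸ mem_range_self _ y
    exact ⟨x, hh (by rw [hc, hx])⟩

end IsTotallyAcyclic

namespace totallyReflexive

variable {M : ModuleCat.{u} R} (hM : totallyReflexive R M)

include hM

theorem exists_isTotallyAcyclic : ∃ (F : ChainComplex (ModuleCat.{u} R) ℤ) (g : F.X (-1) →ₗ[R] M),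
    IsTotallyAcyclic F ∧ Function.Exact (F.d 0 (-1)).hom g ∧ Function.Surjective g := by
  obtain ⟨F, hfree, hex, hdex, ⟨e⟩⟩ := hM
  refine ⟨F, e.symm.toLinearMap ∘ₗ (range (F.d 0 (-1)).hom).mkQ, ⟨hfree, ?_, ?_⟩, ?_,
    e.symm.surjective.comp (Submodule.mkQ_surjective _)⟩
  · rintro _ b c rfl hc
    obtain rfl : b - 1 = c := by lia
    exact hex b
  · rintro _ b c rfl hc
    obtain rfl : b - 1 = c := by lia
    exact hdex b
  · intro x
    rw [LinearMap.comp_apply]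
    change e.symm _ = 0 ↔ _
    rw [map_eq_zero_iff e.symm e.symm.injective, Submodule.mkQ_apply,
      Submodule.Quotient.mk_eq_zero]
    rfl

theorem finite : Module.Finite R M := by
  obtain ⟨F, g, hF, -, hg⟩ := hM.exists_isTotallyAcyclic
  have := (hF.finFree (-1)).1
  exact Module.Finite.of_surjective g hg

theorem exists_syzygy : ∃ (K F : ModuleCat.{u} R) (f : K →ₗ[R] F) (g : F →ₗ[R] M),
    totallyReflexive R K ∧ finFree R F ∧ Function.Injective f ∧ Function.Exact f g ∧
      Function.Surjective g ∧ Function.Surjective f.dualMap := by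
  obtain ⟨F, g, hF, hg, hg'⟩ := hM.exists_isTotallyAcyclic
  refine ⟨ModuleCat.of R (range (F.d 0 (-1)).hom), F.X (-1), (range (F.d 0 (-1)).hom).subtype, g,
    hF.totallyReflexive_of_range_eq (b := 0) (c := -1) (by lia) Subtype.val_injective
      (Submodule.range_subtype _), hF.finFree _, Subtype.val_injective, fun x => ?_, hg',
    fun φ => ?_⟩
  · rw [hg x, Submodule.coe_subtype, Subtype.range_coe]
    rfl
  -- A functional on the image of d₀ pulls back to a cocycle on F₀, so exactness of the dual complex
  -- extends it to F₋₁.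
  · obtain ⟨ψ, hψ⟩ := (hF.dual_exact 1 0 (-1) (by lia) (by lia)
      (φ ∘ₗ (F.d 0 (-1)).hom.rangeRestrict)).1 (by
        ext x
        have : (F.d 0 (-1)).hom.rangeRestrict ((F.d 1 0).hom x) = 0 :=
          Subtype.ext ((hF.exact 1 0 (-1) (by lia) (by lia)).apply_apply_eq_zero x)
        change φ ((F.d 0 (-1)).hom.rangeRestrict ((F.d 1 0).hom x)) = 0
        rw [this, map_zero])
    refine ⟨ψ, ?_⟩
    ext ⟨_, x, rfl⟩
    exact LinearMap.congr_fun hψ x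

theorem subsingleton_ext_self {i : ℕ} (hi : 0 < i) :
    Subsingleton (Ext.{u} M (ModuleCat.of R R) i) := by
  obtain ⟨i, rfl⟩ := Nat.exists_eq_succ_of_ne_zero hi.ne'
  clear hi
  induction i generalizing M with
  | zero =>
    obtain ⟨K, F, f, g, hK, hF, hf, hfg, hg, hfd⟩ := hM.exists_syzygy
    have hS := shortExact_of_linearMap hf hfg hg
    refine subsingleton_of_forall_eq 0 fun x => ?_
    obtain ⟨y, rfl⟩ := Ext.contravariant_sequence_exact₃ hS _ x
      ((subsingleton_ext_of_finFree hF _ one_pos).elim _ _) (add_zero 1)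
    obtain ⟨y, rfl⟩ := (Ext.mk₀_bijective _ _).2 y
    obtain ⟨ψ, hψ⟩ := hfd y.hom
    have hy : y = ModuleCat.ofHom f ≫ ModuleCat.ofHom ψ := ModuleCat.hom_ext hψ.symm
    rw [hy, ← Ext.mk₀_comp_mk₀]
    exact hS.extClass_comp_assoc _
  | succ i ih =>
    obtain ⟨K, F, f, g, hK, hF, hf, hfg, hg, -⟩ := hM.exists_syzygy
    exact subsingleton_ext_X₃ (shortExact_of_linearMap hf hfg hg)
      (subsingleton_ext_of_finFree hF _ (by lia)) (ih hK)

theorem dual : totallyReflexive R (ModuleCat.of R (Module.Dual R M)) := by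
  obtain ⟨F, g, hF, hg, hg'⟩ := hM.exists_isTotallyAcyclic
  -- F₋₁* and F₋₂* sit in degrees 1 and 2 of the dual complex; M* is the kernel of F₋₁* → F₀*, which
  -- is the image of F₋₂*.
  refine hF.dual.totallyReflexive_of_range_eq (b := 2) (c := 1) (by lia) (h := g.dualMap)
    (LinearMap.dualMap_injective_of_surjective hg') ?_
  have h₁ : Function.Exact g.dualMap (F.d 0 (-1)).hom.dualMap :=
    exact_lcomp_of_exact_of_surjective R hg hg'
  have h₂ : Function.Exact (F.d (-1) (-2)).hom.dualMap (F.d 0 (-1)).hom.dualMap :=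
    hF.dual_exact 0 (-1) (-2) (by lia) (by lia)
  exact h₁.linearMap_ker_eq.symm.trans h₂.linearMap_ker_eq

end totallyReflexive

end TotallyReflexive

/-! ### Schanuel's lemma and closure under stable direct summands. -/

section StableSummands

open Abelian LinearMap

variable {R : Type u} [CommRing R]

/-- Modules embedded with the same image are isomorphic. -/
noncomputable def equivOfRangeEq {A B X : Type u} [AddCommGroup A] [AddCommGroup B]
    [AddCommGroup X] [Module R A] [Module R B] [Module R X] {f : A →ₗ[R] X} {g : B →ₗ[R] X}
    (hf : Function.Injective f) (hg : Function.Injective g) (h : range f = range g) : A ≃ₗ[R] B :=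
  LinearEquiv.ofInjective f hf ≪≫ₗ LinearEquiv.ofEq _ _ h ≪≫ₗ (LinearEquiv.ofInjective g hg).symm

/-- Schanuel's lemma. -/
theorem nonempty_linearEquiv_of_schanuel {K P K' P' W : Type u} [AddCommGroup K] [AddCommGroup P]
    [AddCommGroup K'] [AddCommGroup P'] [AddCommGroup W] [Module R K] [Module R P] [Module R K']
    [Module R P'] [Module R W] [Module.Projective R P] [Module.Projective R P']
    {f : K →ₗ[R] P} {g : P →ₗ[R] W} {f' : K' →ₗ[R] P'} {g' : P' →ₗ[R] W}
    (hf : Function.Injective f) (hfg : Function.Exact f g) (hg : Function.Surjective g)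
    (hf' : Function.Injective f') (hfg' : Function.Exact f' g') (hg' : Function.Surjective g') :
    Nonempty ((K × P') ≃ₗ[R] (K' × P)) := by
  obtain ⟨α, hα⟩ := Module.projective_lifting_property g g' hg
  obtain ⟨β, hβ⟩ := Module.projective_lifting_property g' g hg'
  have hα' : ∀ x, g (α x) = g' x := fun x => LinearMap.congr_fun hα x
  have hβ' : ∀ x, g' (β x) = g x := fun x => LinearMap.congr_fun hβ x
  -- Both products embed in P × P' with image the kernel of (p, p') ↦ g p + g' p'.
  let i₁ : K × P' →ₗ[R] P × P' := (f.coprod α).prod (-snd R K P')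
  let i₂ : K' × P →ₗ[R] P × P' := (snd R K' P).prod (f'.coprod (-β))
  refine ⟨equivOfRangeEq (f := i₁) (g := i₂) ?_ ?_ ?_⟩
  · rw [injective_iff_map_eq_zero]
    rintro ⟨k, p⟩ h
    obtain ⟨h₁, h₂⟩ := Prod.ext_iff.1 h
    have hp : p = 0 := neg_eq_zero.1 h₂
    subst hp
    have hk : f k + α 0 = 0 := h₁
    rw [map_zero, add_zero, map_eq_zero_iff f hf] at hk
    rw [hk]
    rfl
  · rw [injective_iff_map_eq_zero]
    rintro ⟨k, p⟩ h
    obtain ⟨h₁, h₂⟩ := Prod.ext_iff.1 h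
    have hp : p = 0 := h₁
    subst hp
    have hk : f' k + -β 0 = 0 := h₂
    rw [map_zero, neg_zero, add_zero, map_eq_zero_iff f' hf'] at hk
    rw [hk]
    rfl
  · have h₁ : range i₁ = ker (g.coprod g') := by
      ext ⟨p, p'⟩
      constructor
      · rintro ⟨⟨k, x⟩, h⟩
        obtain ⟨rfl, rfl⟩ := Prod.ext_iff.1 h
        change g (f k + α x) + g' (-x) = 0
        rw [map_add, hfg.apply_apply_eq_zero, hα', map_neg, zero_add, add_neg_cancel]
      · intro h
        have h : g p + g' p' = 0 := h
        obtain ⟨k, hk⟩ := (hfg (p + α p')).1 (by rw [map_add, hα', h])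
        refine ⟨(k, -p'), Prod.ext ?_ (neg_neg p')⟩
        change f k + α (-p') = p
        rw [hk, map_neg, add_neg_cancel_right]
    have h₂ : range i₂ = ker (g.coprod g') := by
      ext ⟨p, p'⟩
      constructor
      · rintro ⟨⟨k, x⟩, h⟩
        obtain ⟨rfl, rfl⟩ := Prod.ext_iff.1 h
        change g x + g' (f' k + -β x) = 0
        rw [map_add, hfg'.apply_apply_eq_zero, map_neg, hβ', zero_add, add_neg_cancel]
      · intro h
        have h : g p + g' p' = 0 := h
        obtain ⟨k, hk⟩ := (hfg' (p' + β p)).1 (by rw [map_add, hβ', add_comm, h])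
        refine ⟨(k, p), Prod.ext rfl ?_⟩
        change f' k + -β p = p'
        rw [hk, add_neg_cancel_right]
    rw [h₁, h₂]

theorem finFree_prod {M N : ModuleCat.{u} R} (hM : finFree R M) (hN : finFree R N) :
    finFree R (ModuleCat.of R (M × N)) := by
  have := hM.1
  have := hM.2
  have := hN.1
  have := hN.2
  exact ⟨inferInstanceAs (Module.Finite R (M × N)), inferInstanceAs (Module.Free R (M × N))⟩

theorem finFree_dual {M : ModuleCat.{u} R} (hM : finFree R M) :
    finFree R (ModuleCat.of R (Module.Dual R M)) := by
  have := hM.1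
  have := hM.2
  exact ⟨inferInstanceAs (Module.Finite R (Module.Dual R M)),
    inferInstanceAs (Module.Free R (Module.Dual R M))⟩

/-- Modules that are, up to free summands, direct summands of modules in `P`. -/
def stableSummand (P : ObjectProperty (ModuleCat.{u} R)) : ObjectProperty (ModuleCat.{u} R) :=
  fun M => ∃ N G F : ModuleCat.{u} R, P G ∧ finFree R F ∧ Nonempty ((M × N) ≃ₗ[R] (G × F))

variable {P : ObjectProperty (ModuleCat.{u} R)}

theorem le_stableSummand {M : ModuleCat.{u} R} (hM : P M) : stableSummand P M :=
  ⟨ModuleCat.of R PUnit, M, ModuleCat.of R PUnit, hM, ⟨inferInstance, inferInstance⟩,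
    ⟨LinearEquiv.refl R _⟩⟩

/-- Ext in positive degrees ignores free summands and passes to direct summands; hence enlarging the
class keeps its right orthogonal and its approximations. -/
theorem stableSummand_subsingleton_ext {M C : ModuleCat.{u} R} (hM : stableSummand P M) {i : ℕ}
    (hi : 0 < i) (h : ∀ X, P X → Subsingleton (Ext.{u} X C i)) : Subsingleton (Ext.{u} M C i) := by
  obtain ⟨N, G, F, hG, hF, ⟨e⟩⟩ := hM
  have hS := shortExact_of_linearMap (inr_injective : Function.Injective (inr R G F))
    (Function.Exact.inr_fst) fst_surjective
  have := subsingleton_ext_X₂ hS (subsingleton_ext_of_finFree hF C hi) (h G hG)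
  refine subsingleton_ext_of_retract
    { i := ModuleCat.ofHom (e.toLinearMap ∘ₗ inl R M N)
      r := ModuleCat.ofHom (fst R M N ∘ₗ e.symm.toLinearMap)
      retract := ?_ } this
  ext x
  simp

theorem rightPerp_stableSummand {L : ModuleCat.{u} R} (hL : rightPerp P L) :
    rightPerp (stableSummand P) L :=
  ⟨hL.1, fun _ hX _ hi => stableSummand_subsingleton_ext hX hi fun X hX => hL.2 X hX _ hi⟩

theorem stableSummand_finite (hP : ∀ M, P M → Module.Finite R M) {M N G F : ModuleCat.{u} R}
    (hG : P G) (hF : finFree R F) (e : (M × N) ≃ₗ[R] (G × F)) :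
    Module.Finite R M ∧ Module.Finite R N := by
  have := hP G hG
  have := hF.1
  have : Module.Finite R (M × N) := Module.Finite.equiv e.symm
  exact ⟨Module.Finite.of_surjective (fst R M N) fst_surjective,
    Module.Finite.of_surjective (snd R M N) snd_surjective⟩

/-- If every module in `P` has a syzygy in `P`, then every syzygy of a module in the stable closure
of `P` under direct summands is in that closure. -/
theorem stableSummand_syzygy [IsNoetherianRing R] (hfin : ∀ M, P M → Module.Finite R M)
    (hsyz : ∀ M, P M → ∃ (K F : ModuleCat.{u} R) (f : K →ₗ[R] F) (g : F →ₗ[R] M),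
      P K ∧ finFree R F ∧ Function.Injective f ∧ Function.Exact f g ∧ Function.Surjective g)
    {K F M : ModuleCat.{u} R} {f : K →ₗ[R] F} {g : F →ₗ[R] M} (hF : finFree R F)
    (hf : Function.Injective f) (hfg : Function.Exact f g) (hg : Function.Surjective g)
    (hM : stableSummand P M) : stableSummand P K := by
  obtain ⟨N, G, F₀, hG, hF₀, ⟨e⟩⟩ := hM
  have := (stableSummand_finite hfin hG hF₀ e).2
  obtain ⟨K₁, F₁, f₁, g₁, hF₁, hf₁, hfg₁, hg₁⟩ := exists_syzygy N
  obtain ⟨K₂, F₂, f₂, g₂, hK₂, hF₂, hf₂, hfg₂, hg₂⟩ := hsyz G hG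
  have hFF₁ := finFree_prod hF hF₁
  have hF₂F₀ := finFree_prod hF₂ hF₀
  have : Module.Projective R (F × F₁) := @Module.Projective.of_free _ _ _ _ _ hFF₁.2
  have : Module.Projective R (F₂ × F₀) := @Module.Projective.of_free _ _ _ _ _ hF₂F₀.2
  have hsur : Function.Surjective (e.toLinearMap ∘ₗ g.prodMap g₁) :=
    e.surjective.comp (Function.Surjective.prodMap hg hg₁)
  have hex : Function.Exact (f.prodMap f₁) (e.toLinearMap ∘ₗ g.prodMap g₁) := fun x => by
    rw [LinearMap.comp_apply]
    change e _ = 0 ↔ _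
    rw [map_eq_zero_iff e e.injective]
    rw [Prod.ext_iff]
    refine (and_congr (hfg x.1) (hfg₁ x.2)).trans ⟨?_, ?_⟩
    · rintro ⟨⟨k, hk⟩, k₁, hk₁⟩
      exact ⟨(k, k₁), Prod.ext hk hk₁⟩
    · rintro ⟨k, rfl⟩
      exact ⟨⟨k.1, rfl⟩, k.2, rfl⟩
  have hex' : Function.Exact (inl R F₂ F₀ ∘ₗ f₂) (g₂.prodMap (LinearMap.id : F₀ →ₗ[R] F₀)) := by
    rintro ⟨x, y⟩
    constructor
    · intro h
      obtain ⟨h₁, h₂⟩ := Prod.ext_iff.1 h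
      obtain ⟨k, rfl⟩ := (hfg₂ x).1 h₁
      exact ⟨k, Prod.ext rfl (show (0 : F₀) = y from (show y = 0 from h₂).symm)⟩
    · rintro ⟨k, hk⟩
      obtain ⟨rfl, rfl⟩ := Prod.ext_iff.1 hk
      exact Prod.ext (hfg₂.apply_apply_eq_zero k) rfl
  -- Two free covers of G × F₀: one covers M × N and has kernel K × K₁, the other has kernel K₂ in
  -- the class.
  obtain ⟨e'⟩ := nonempty_linearEquiv_of_schanuel (Function.Injective.prodMap hf hf₁) hex hsur
    (inl_injective.comp hf₂) hex' (Function.Surjective.prodMap hg₂ Function.surjective_id)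
  exact ⟨ModuleCat.of R (K₁ × (F₂ × F₀)), K₂, ModuleCat.of R (F × F₁), hK₂, hFF₁,
    ⟨(LinearEquiv.prodAssoc R K K₁ (F₂ × F₀)).symm ≪≫ₗ e'⟩⟩

/-- One syzygy in P for each module of P suffices: the enlarged class absorbs the choice of free
cover. -/
theorem isSyzygyDualClosed_stableSummand [IsNoetherianRing R]
    (hfin : ∀ M, P M → Module.Finite R M) (hself : rightPerp P (ModuleCat.of R R))
    (hsyz : ∀ M, P M → ∃ (K F : ModuleCat.{u} R) (f : K →ₗ[R] F) (g : F →ₗ[R] M),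
      P K ∧ finFree R F ∧ Function.Injective f ∧ Function.Exact f g ∧ Function.Surjective g)
    (hdual : ∀ M, P M → P (ModuleCat.of R (Module.Dual R M))) :
    IsSyzygyDualClosed (stableSummand P) where
  finite _ := fun ⟨_, _, _, hG, hF, ⟨e⟩⟩ => (stableSummand_finite hfin hG hF e).1
  self_mem_perp := rightPerp_stableSummand hself
  syzygy _ _ _ _ _ hF hf hfg hg hM := stableSummand_syzygy hfin hsyz hF hf hfg hg hM
  dual M := fun ⟨N, G, F, hG, hF, ⟨e⟩⟩ =>
    ⟨ModuleCat.of R (Module.Dual R N), ModuleCat.of R (Module.Dual R G),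
      ModuleCat.of R (Module.Dual R F), hdual G hG, finFree_dual hF,
      ⟨Module.dualProdDualEquivDual R M N ≪≫ₗ e.symm.dualMap ≪≫ₗ
        (Module.dualProdDualEquivDual R G F).symm⟩⟩

end StableSummands

/-! ### Free modules in a reflexive subcategory, and the theorem. -/

theorem IsReflexiveSubcategory.of_finFree {R : Type u} [CommRing R] [Nontrivial R]
    {B : ObjectProperty (ModuleCat.{u} R)} (hB : IsReflexiveSubcategory B) {M : ModuleCat.{u} R}
    (hM : finFree R M) : B M := by
  have hpow : ∀ n : ℕ, B (ModuleCat.of R (Fin n → R)) := fun n => by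
    induction n with
    | zero =>
      -- The zero module belongs to the class as a direct summand of R.
      exact ((hB.prod_iff (ModuleCat.of R R) (ModuleCat.of R (Fin 0 → R))).1
        (hB.iso _ _ ⟨(LinearEquiv.prodUnique : (R × (Fin 0 → R)) ≃ₗ[R] R).symm⟩ hB.self_mem)).2
    | succ n ih =>
      exact hB.iso _ _ ⟨(Fin.consLinearEquiv R fun _ : Fin (n + 1) => R)⟩
        ((hB.prod_iff (ModuleCat.of R R) (ModuleCat.of R (Fin n → R))).2 ⟨hB.self_mem, ih⟩)
  have := hM.1
  have := hM.2
  exact hB.iso _ _ ⟨(Module.finBasis R M).equivFun.symm⟩ (hpow _)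

theorem theorem3p4 (R : Type u) [CommRing R] [IsNoetherianRing R] [IsLocalRing R] :
    (∀ B : ObjectProperty (ModuleCat.{u} R), IsReflexiveSubcategory B →
      HasApproximation B (ModuleCat.of R (IsLocalRing.ResidueField R)) →
      IsGorensteinLocal R ∨ B = finFree R) ∧
    ((∃ G : ModuleCat.{u} R, totallyReflexive R G ∧ ¬ Module.Free R G) →
      HasApproximation (totallyReflexive R) (ModuleCat.of R (IsLocalRing.ResidueField R)) →
      IsGorensteinLocal R) := by
  refine ⟨fun B hB ⟨L, X, f, g, hL, hX, hf, hfg, hg⟩ => ?_,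
    fun ⟨G, hG, hfree⟩ ⟨L, X, f, g, hL, hX, hf, hfg, hg⟩ => ?_⟩
  · by_cases h : ∀ M, B M → Module.Free R M
    · refine Or.inr (funext fun M => propext ⟨fun hM => ⟨hB.finite M hM, h M hM⟩, hB.of_finFree⟩)
    · push Not at h
      obtain ⟨M, hM, hfree⟩ := h
      exact Or.inl (hB.isSyzygyDualClosed.isGorensteinLocal hL hX hf hfg hg hM hfree)
  · have hP : IsSyzygyDualClosed (stableSummand (totallyReflexive R)) :=
      isSyzygyDualClosed_stableSummand (fun _ hM => hM.finite)
        ⟨Module.Finite.self R, fun _ hM _ hi => hM.subsingleton_ext_self hi⟩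
        (fun _ hM => by
          obtain ⟨K, F, f, g, hK, hF, hf, hfg, hg, -⟩ := hM.exists_syzygy
          exact ⟨K, F, f, g, hK, hF, hf, hfg, hg⟩)
        fun _ hM => hM.dual
    exact hP.isGorensteinLocal (rightPerp_stableSummand hL) (le_stableSummand hX) hf hfg hg
      (le_stableSummand hG) hfree
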